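/- Let $N\ge 1$, let $\gamma\in\mathbb{R}$, and let $\Gamma$ be the star graph consisting of a central vertex and $N$ half-lines $J_e=(0,+\infty)$, $e=1,\dots,N$, attached to it at $0$. A function $u=(u_e)_{e=1}^N$ on $\Gamma$ is complex valued. It is continuous on $\Gamma$ if every $u_e$ is continuous on $[0,\infty)$ and $u_e(0)=u_r(0)$ for all $e,r$; this common value is denoted by $u(0)$. Let $$A(s)=\begin{cases}-s^2\,\mathrm{Log}(s^2), & 0\le s\le e^{-3},\\ 3s^2+4e^{-3}s-e^{-6}, & s\ge e^{-3},\end{cases}$$ with $0\,\mathrm{Log}\,0=0$. Let $L^A(\mathbb{R}^+)=\{f\in L^1_{\mathrm{loc}}(\mathbb{R}^+): A(|f|)\in L^1(\mathbb{R}^+)\}$ with the Luxemburg norm $\|f\|_{L^A}=\inf\{k>0:\int_{\mathbb{R}^+}A(k^{-1}|f(x)|)\,dx\le 1\}$. Let $W(\mathbb{R}^+)=H^1(\mathbb{R}^+)\cap L^A(\mathbb{R}^+)$ with the norm $\|f\|_{W(\mathbb{R}^+)}=\|f\|_{H^1(\mathbb{R}^+)}+\|f\|_{L^A(\mathbb{R}^+)}$.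 Let $W(\Gamma)$ be the space of all continuous functions $u$ on $\Gamma$ such that $u_e\in W(\mathbb{R}^+)$ for $e=1,\dots,N$, with the norm $\|u\|_{W(\Gamma)}^2=\sum_{e=1}^N\|u_e\|_{W(\mathbb{R}^+)}^2$. Let $W'(\Gamma)$ be its dual, that is, the space of continuous real-linear functionals $W(\Gamma)\to\mathbb{R}$ with the operator norm. For $u,v\in W(\Gamma)$ define $$\mathfrak{F}_\gamma[u,v]=\mathrm{Re}\sum_{e=1}^N\int_0^\infty u_e'(x)\overline{v_e'(x)}\,dx-\gamma\,\mathrm{Re}\bigl(u(0)\overline{v(0)}\bigr),\qquad \mathfrak{F}_\gamma[u]=\mathfrak{F}_\gamma[u,u],$$ $$E(u)=\frac12\mathfrak{F}_\gamma[u]-\frac12\sum_{e=1}^N\int_0^\infty|u_e|^2\,\mathrm{Log}|u_e|^2\,dx .$$ Then $|u_e|^2\,\mathrm{Log}|u_e|^2\in L^1(\mathbb{R}^+)$ for all $u\in W(\Gamma)$ and all $e$, so that $E:W(\Gamma)\to\mathbb{R}$ is well defined, and $E$ is of class $C^1$ on $W(\Gamma)$ (regarded as a real normed space). For every $u\in W(\Gamma)$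 the Fréchet derivative of $E$ at $u$ is $$E'(u)=-\Delta_\gamma u-u\,\mathrm{Log}|u|^2-u\quad\text{in } W'(\Gamma),$$ where each of the three terms is an element of $W'(\Gamma)$, given for $v\in W(\Gamma)$ by $$\langle-\Delta_\gamma u,v\rangle=\mathfrak{F}_\gamma[u,v],\qquad \langle u\,\mathrm{Log}|u|^2,v\rangle=\mathrm{Re}\sum_{e=1}^N\int_0^\infty u_e\,\mathrm{Log}|u_e|^2\,\overline{v_e}\,dx,\qquad \langle u,v\rangle=\mathrm{Re}\sum_{e=1}^N\int_0^\infty u_e\,\overline{v_e}\,dx,$$ and the integrands of the last two pairings are integrable. -/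

import Mathlib

open MeasureTheory Set
open scoped NNReal ENNReal ContDiff ComplexConjugate

namespace StarGraph

noncomputable section

/-! ### The half-line: `L²`, weak derivatives, `H¹`, the Orlicz space `L^A` and `W(ℝ⁺)` -/

/-- The `L²(ℝ⁺)`-norm. -/
def l2Norm (f : ℝ → ℂ) : ℝ := (eLpNorm f 2 (volume.restrict (Ioi 0))).toReal

/-- `g` is the weak (distributional) derivative of `f` on `(0, ∞)`. -/
def HasWeakDeriv (f g : ℝ → ℂ) : Prop :=
  LocallyIntegrableOn f (Ioi 0) ∧ LocallyIntegrableOn g (Ioi 0) ∧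
    ∀ φ : ℝ → ℝ, ContDiff ℝ ∞ φ → HasCompactSupport φ → tsupport φ ⊆ Ioi 0 →
      ∫ x in Ioi 0, deriv φ x • f x = -∫ x in Ioi 0, φ x • g x

/-- `f ∈ H¹(ℝ⁺)`. -/
def MemH1 (f : ℝ → ℂ) : Prop :=
  MemLp f 2 (volume.restrict (Ioi 0)) ∧
    ∃ g : ℝ → ℂ, MemLp g 2 (volume.restrict (Ioi 0)) ∧ HasWeakDeriv f g

open Classical in
/-- The weak derivative of `f ∈ H¹(ℝ⁺)`, an `L²` function which is unique almost everywhere on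
`(0, ∞)`. -/
def weakDeriv (f : ℝ → ℂ) : ℝ → ℂ := if h : MemH1 f then h.2.choose else 0

/-- The `H¹(ℝ⁺)`-norm. -/
def h1Norm (f : ℝ → ℂ) : ℝ := √(l2Norm f ^ 2 + l2Norm (weakDeriv f) ^ 2)

/-- The Young function `A` on `[0, ∞)`. -/
def orliczA (s : ℝ) : ℝ :=
  if s ≤ Real.exp (-3) then -s ^ 2 * Real.log (s ^ 2)
  else 3 * s ^ 2 + 4 * Real.exp (-3) * s - Real.exp (-6)

/-- `f ∈ L^A(ℝ⁺)`. -/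
def MemLA (f : ℝ → ℂ) : Prop :=
  LocallyIntegrableOn f (Ioi 0) ∧ IntegrableOn (fun x => orliczA ‖f x‖) (Ioi 0)

/-- The Luxemburg norm on `L^A(ℝ⁺)`. -/
def luxNorm (f : ℝ → ℂ) : ℝ :=
  sInf {k : ℝ | 0 < k ∧ ∫⁻ x in Ioi 0, ENNReal.ofReal (orliczA (k⁻¹ * ‖f x‖)) ≤ 1}

/-- `f ∈ W(ℝ⁺) = H¹(ℝ⁺) ∩ L^A(ℝ⁺)`. -/
def MemWHalf (f : ℝ → ℂ) : Prop := MemH1 f ∧ MemLA f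

/-- The `W(ℝ⁺)`-norm. -/
def wHalfNorm (f : ℝ → ℂ) : ℝ := h1Norm f + luxNorm f

/-! ### Facts about the half-line spaces -/

theorem weakDeriv_memLp {f : ℝ → ℂ} (h : MemH1 f) :
    MemLp (weakDeriv f) 2 (volume.restrict (Ioi 0)) := by
  rw [weakDeriv, dif_pos h]; exact h.2.choose_spec.1

theorem hasWeakDeriv_weakDeriv {f : ℝ → ℂ} (h : MemH1 f) : HasWeakDeriv f (weakDeriv f) := by
  rw [weakDeriv, dif_pos h]; exact h.2.choose_spec.2

theorem integrable_smul_of_test {φ : ℝ → ℝ} {f : ℝ → ℂ} (hf : LocallyIntegrableOn f (Ioi 0))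
    (hφ : Continuous φ) (hc : HasCompactSupport φ) (hs : tsupport φ ⊆ Ioi 0) :
    IntegrableOn (fun x => φ x • f x) (Ioi 0) := by
  have h1 : IntegrableOn f (tsupport φ) := hf.integrableOn_compact_subset hs hc
  have h2 : IntegrableOn (fun x => φ x • f x) (tsupport φ) :=
    h1.continuousOn_smul hφ.continuousOn hc
  have h3 : Integrable (fun x => φ x • f x) := by
    rw [← integrableOn_iff_integrable_of_support_subset (s := tsupport φ)]
    · exact h2
    · intro x hx
      apply subset_tsupport
      intro h0
      apply hx
      simp [h0]
  exact h3.integrableOn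

theorem HasWeakDeriv.ae_eq {f g g' : ℝ → ℂ} (h : HasWeakDeriv f g) (h' : HasWeakDeriv f g') :
    g =ᵐ[volume.restrict (Ioi 0)] g' := by
  have key := isOpen_Ioi.ae_eq_zero_of_integral_contDiff_smul_eq_zero (U := Ioi (0 : ℝ))
    (μ := (volume : Measure ℝ).restrict (Ioi 0)) (f := g - g')
    (by
      intro x hx
      have := (h.2.1.sub h'.2.1) x hx
      obtain ⟨s, hs, hi⟩ := this
      exact ⟨s, hs, hi.mono_measure Measure.restrict_le_self⟩)
    (by
      intro φ h1 h2 h3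
      have i1 := integrable_smul_of_test h.2.1 h1.continuous h2 h3
      have i2 := integrable_smul_of_test h'.2.1 h1.continuous h2 h3
      have e1 := h.2.2 φ h1 h2 h3
      have e2 := h'.2.2 φ h1 h2 h3
      have : ∫ x in Ioi 0, φ x • (g - g') x
          = (∫ x in Ioi 0, φ x • g x) - ∫ x in Ioi 0, φ x • g' x := by
        rw [← integral_sub i1 i2]
        simp [smul_sub]
      rw [this, sub_eq_zero]
      exact neg_injective (e1.symm.trans e2))
  filter_upwards [key, ae_restrict_mem measurableSet_Ioi] with x hx hx0
  have := hx hx0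
  simpa [sub_eq_zero] using this

theorem HasWeakDeriv.add {f g f' g' : ℝ → ℂ} (hf : HasWeakDeriv f f') (hg : HasWeakDeriv g g') :
    HasWeakDeriv (f + g) (f' + g') := by
  refine ⟨hf.1.add hg.1, hf.2.1.add hg.2.1, fun φ h1 h2 h3 => ?_⟩
  have hd : Continuous (deriv φ) := h1.continuous_deriv (by simp)
  have hdc : HasCompactSupport (deriv φ) := h2.deriv
  have hds : tsupport (deriv φ) ⊆ Ioi 0 :=
    (closure_minimal (support_deriv_subset) (isClosed_tsupport φ)).trans h3
  have := hf.2.2 φ h1 h2 h3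
  have := hg.2.2 φ h1 h2 h3
  simp only [Pi.add_apply, smul_add]
  rw [integral_add (integrable_smul_of_test hf.1 hd hdc hds)
      (integrable_smul_of_test hg.1 hd hdc hds),
    integral_add (integrable_smul_of_test hf.2.1 h1.continuous h2 h3)
      (integrable_smul_of_test hg.2.1 h1.continuous h2 h3)]
  simp_all [add_comm]

theorem HasWeakDeriv.smul {f f' : ℝ → ℂ} (c : ℂ) (hf : HasWeakDeriv f f') :
    HasWeakDeriv (c • f) (c • f') := by
  refine ⟨hf.1.smul c, hf.2.1.smul c, fun φ h1 h2 h3 => ?_⟩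
  have := hf.2.2 φ h1 h2 h3
  simp only [Pi.smul_apply, smul_comm _ c]
  rw [integral_smul, integral_smul, this, smul_neg]

theorem MemH1.add {f g : ℝ → ℂ} (hf : MemH1 f) (hg : MemH1 g) : MemH1 (f + g) :=
  ⟨hf.1.add hg.1, _, (weakDeriv_memLp hf).add (weakDeriv_memLp hg),
    (hasWeakDeriv_weakDeriv hf).add (hasWeakDeriv_weakDeriv hg)⟩

theorem MemH1.smul {f : ℝ → ℂ} (c : ℂ) (hf : MemH1 f) : MemH1 (c • f) :=
  ⟨hf.1.const_smul c, _, (weakDeriv_memLp hf).const_smul c, (hasWeakDeriv_weakDeriv hf).smul c⟩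

theorem memH1_zero : MemH1 (0 : ℝ → ℂ) := by
  refine ⟨MemLp.zero, 0, MemLp.zero, ?_, ?_, ?_⟩
  · exact (locallyIntegrable_zero).locallyIntegrableOn _
  · exact (locallyIntegrable_zero).locallyIntegrableOn _
  · simp

theorem weakDeriv_add {f g : ℝ → ℂ} (hf : MemH1 f) (hg : MemH1 g) :
    weakDeriv (f + g) =ᵐ[volume.restrict (Ioi 0)] weakDeriv f + weakDeriv g :=
  (hasWeakDeriv_weakDeriv (hf.add hg)).ae_eq
    ((hasWeakDeriv_weakDeriv hf).add (hasWeakDeriv_weakDeriv hg))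

theorem weakDeriv_smul {f : ℝ → ℂ} (c : ℂ) (hf : MemH1 f) :
    weakDeriv (c • f) =ᵐ[volume.restrict (Ioi 0)] c • weakDeriv f :=
  (hasWeakDeriv_weakDeriv (hf.smul c)).ae_eq ((hasWeakDeriv_weakDeriv hf).smul c)

theorem l2Norm_nonneg (f : ℝ → ℂ) : 0 ≤ l2Norm f := ENNReal.toReal_nonneg

theorem l2Norm_congr {f g : ℝ → ℂ} (h : f =ᵐ[volume.restrict (Ioi 0)] g) :
    l2Norm f = l2Norm g := by rw [l2Norm, l2Norm, eLpNorm_congr_ae h]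

theorem l2Norm_add_le {f g : ℝ → ℂ} (hf : MemLp f 2 (volume.restrict (Ioi 0)))
    (hg : MemLp g 2 (volume.restrict (Ioi 0))) : l2Norm (f + g) ≤ l2Norm f + l2Norm g := by
  rw [l2Norm, l2Norm, l2Norm, ← ENNReal.toReal_add hf.2.ne hg.2.ne]
  exact ENNReal.toReal_mono (ENNReal.add_ne_top.2 ⟨hf.2.ne, hg.2.ne⟩)
    (eLpNorm_add_le hf.1 hg.1 (by norm_num))

theorem l2Norm_smul (c : ℂ) (f : ℝ → ℂ) : l2Norm (c • f) = ‖c‖ * l2Norm f := by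
  rw [l2Norm, eLpNorm_const_smul, ENNReal.toReal_mul]; simp [l2Norm]

/-- Minkowski's inequality for the Euclidean norm. -/
theorem sqrt_sum_add_sq_le {ι : Type*} [Fintype ι] (a b : ι → ℝ) :
    √(∑ i, (a i + b i) ^ 2) ≤ √(∑ i, a i ^ 2) + √(∑ i, b i ^ 2) := by
  have := norm_add_le (WithLp.toLp 2 a : EuclideanSpace ℝ ι) (WithLp.toLp 2 b)
  simpa [EuclideanSpace.norm_eq] using this

theorem h1Norm_add_le {f g : ℝ → ℂ} (hf : MemH1 f) (hg : MemH1 g) :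
    h1Norm (f + g) ≤ h1Norm f + h1Norm g := by
  have h1 := l2Norm_add_le hf.1 hg.1
  have h2 := l2Norm_add_le (weakDeriv_memLp hf) (weakDeriv_memLp hg)
  rw [← l2Norm_congr (weakDeriv_add hf hg)] at h2
  have h3 := sqrt_sum_add_sq_le ![l2Norm f, l2Norm (weakDeriv f)]
    ![l2Norm g, l2Norm (weakDeriv g)]
  simp only [Fin.sum_univ_two, Matrix.cons_val_zero, Matrix.cons_val_one] at h3
  refine le_trans (Real.sqrt_le_sqrt ?_) h3
  exact add_le_add (pow_le_pow_left₀ (l2Norm_nonneg _) h1 2)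
    (pow_le_pow_left₀ (l2Norm_nonneg _) h2 2)

theorem h1Norm_smul {f : ℝ → ℂ} (c : ℂ) (hf : MemH1 f) : h1Norm (c • f) = ‖c‖ * h1Norm f := by
  rw [h1Norm, l2Norm_congr (weakDeriv_smul c hf), l2Norm_smul, l2Norm_smul, mul_pow, mul_pow,
    ← mul_add, Real.sqrt_mul (by positivity), Real.sqrt_sq (norm_nonneg c), h1Norm]

/-! Properties of the Young function. -/

theorem exp_neg_six : Real.exp (-6) = Real.exp (-3) ^ 2 := by
  rw [← Real.exp_nat_mul]; norm_num

theorem log_sq_le {s : ℝ} (hs : 0 < s) (h : s ≤ Real.exp (-3)) : Real.log (s ^ 2) ≤ -6 := by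
  have := Real.log_le_log hs h
  rw [Real.log_exp] at this
  rw [Real.log_pow]; push_cast; linarith

/-- The derivative of the Young function on `(0, ∞)`. -/
def orliczA' (s : ℝ) : ℝ :=
  if s ≤ Real.exp (-3) then -2 * s * Real.log (s ^ 2) - 2 * s
  else 6 * s + 4 * Real.exp (-3)

theorem orliczA_zero : orliczA 0 = 0 := by simp [orliczA, Real.exp_nonneg]

theorem orliczA_eq_right {s : ℝ} (h : Real.exp (-3) ≤ s) :
    orliczA s = 3 * s ^ 2 + 4 * Real.exp (-3) * s - Real.exp (-6) := by
  rcases h.eq_or_lt with h | h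
  · subst h
    rw [orliczA, if_pos le_rfl, exp_neg_six, Real.log_pow, Real.log_exp]; push_cast; ring
  · rw [orliczA, if_neg (not_le.2 h)]

theorem orliczA'_eq_right {s : ℝ} (h : Real.exp (-3) ≤ s) :
    orliczA' s = 6 * s + 4 * Real.exp (-3) := by
  rcases h.eq_or_lt with h | h
  · subst h
    rw [orliczA', if_pos le_rfl, Real.log_pow, Real.log_exp]; push_cast; ring
  · rw [orliczA', if_neg (not_le.2 h)]

theorem hasDerivAt_orliczA {s : ℝ} (hs : 0 < s) : HasDerivAt orliczA (orliczA' s) s := by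
  have hl : HasDerivAt (fun s : ℝ => -s ^ 2 * Real.log (s ^ 2))
      (-2 * s * Real.log (s ^ 2) - 2 * s) s := by
    have h1 : HasDerivAt (fun s : ℝ => s ^ 2) (2 * s) s := by simpa using hasDerivAt_pow 2 s
    have h2 := h1.neg.mul (h1.log (by positivity))
    refine h2.congr_deriv ?_
    simp only [Pi.neg_apply]
    field_simp
    ring
  have hr : HasDerivAt (fun s : ℝ => 3 * s ^ 2 + 4 * Real.exp (-3) * s - Real.exp (-6))
      (6 * s + 4 * Real.exp (-3)) s := by
    have h1 : HasDerivAt (fun s : ℝ => s ^ 2) (2 * s) s := by simpa using hasDerivAt_pow 2 s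
    have h2 := ((h1.const_mul 3).add ((hasDerivAt_id s).const_mul (4 * Real.exp (-3)))).sub_const
      (Real.exp (-6))
    refine h2.congr_deriv ?_
    ring
  have hL : s ≤ Real.exp (-3) → HasDerivWithinAt orliczA (orliczA' s) (Iic (Real.exp (-3))) s := by
    intro h
    rw [orliczA', if_pos h]
    exact hl.hasDerivWithinAt.congr (fun x hx => by rw [orliczA, if_pos (mem_Iic.1 hx)])
      (by rw [orliczA, if_pos h])
  have hR : Real.exp (-3) ≤ s → HasDerivWithinAt orliczA (orliczA' s) (Ici (Real.exp (-3))) s := by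
    intro h
    rw [orliczA'_eq_right h]
    exact hr.hasDerivWithinAt.congr (fun x hx => orliczA_eq_right hx) (orliczA_eq_right h)
  rcases lt_trichotomy s (Real.exp (-3)) with h | h | h
  · exact (hL h.le).hasDerivAt (Iic_mem_nhds h)
  · have := (hL h.le).union (hR h.ge)
    rwa [Iic_union_Ici, hasDerivWithinAt_univ] at this
  · exact (hR h.le).hasDerivAt (Ici_mem_nhds h)

theorem continuous_orliczA : Continuous orliczA := by
  refine Continuous.if_le ?_ ?_ continuous_id continuous_const ?_
  · have h : (fun s : ℝ => -s ^ 2 * Real.log (s ^ 2)) = fun s => -(s ^ 2 * Real.log (s ^ 2)) := by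
      ext; ring
    rw [h]
    exact (Real.continuous_mul_log.comp (continuous_pow 2)).neg
  · fun_prop
  · intro s hs
    have h1 := orliczA_eq_right (s := s) (le_of_eq hs.symm)
    rw [orliczA, if_pos (le_of_eq hs)] at h1
    exact h1

theorem monotoneOn_orliczA' : MonotoneOn orliczA' (Ioi 0) := by
  intro s hs t ht hst
  have hs : 0 < s := hs
  have ht : 0 < t := ht
  have small : ∀ x y : ℝ, 0 < x → x ≤ y → y ≤ Real.exp (-3) → orliczA' x ≤ orliczA' y := by
    intro x y hx hxy hy
    rw [orliczA', orliczA', if_pos hy, if_pos (hxy.trans hy)]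
    have hy0 : 0 < y := hx.trans_le hxy
    have h1 := log_sq_le hy0 hy
    have h2 : Real.log (y / x) ≤ y / x - 1 := Real.log_le_sub_one_of_pos (by positivity)
    rw [Real.log_div hy0.ne' hx.ne'] at h2
    simp only [Real.log_pow] at *
    push_cast at *
    have h3 : x * (Real.log y - Real.log x) ≤ y - x := by
      have := mul_le_mul_of_nonneg_left h2 hx.le
      have e : x * (y / x - 1) = y - x := by field_simp
      linarith
    nlinarith [mul_nonneg (sub_nonneg.2 hxy) (by linarith : 0 ≤ -3 - Real.log y)]
  have big : ∀ x y : ℝ, Real.exp (-3) ≤ x → x ≤ y → orliczA' x ≤ orliczA' y := by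
    intro x y hx hxy
    rw [orliczA'_eq_right hx, orliczA'_eq_right (hx.trans hxy)]
    linarith
  rcases le_total t (Real.exp (-3)) with h | h
  · exact small s t hs hst h
  · rcases le_total s (Real.exp (-3)) with h' | h'
    · exact (small s _ hs h' le_rfl).trans (big _ t le_rfl h)
    · exact big s t h' hst

theorem convexOn_orliczA : ConvexOn ℝ (Ici 0) orliczA := by
  refine MonotoneOn.convexOn_of_deriv (convex_Ici 0) continuous_orliczA.continuousOn ?_ ?_
  · rw [interior_Ici]
    exact fun x hx => (hasDerivAt_orliczA hx).differentiableAt.differentiableWithinAt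
  · rw [interior_Ici]
    intro x hx y hy hxy
    rw [(hasDerivAt_orliczA hx).deriv, (hasDerivAt_orliczA hy).deriv]
    exact monotoneOn_orliczA' hx hy hxy

theorem orliczA_nonneg {s : ℝ} (hs : 0 ≤ s) : 0 ≤ orliczA s := by
  rcases hs.eq_or_lt with rfl | hs0
  · exact orliczA_zero.ge
  rcases le_total s (Real.exp (-3)) with h | h
  · rw [orliczA, if_pos h]
    have := log_sq_le hs0 h
    nlinarith [sq_nonneg s]
  · rw [orliczA_eq_right h, exp_neg_six]
    nlinarith [Real.exp_pos (-3)]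

/-- `A(θ s) ≤ θ A(s)` for `θ ∈ [0, 1]`. -/
theorem orliczA_mul_le {θ s : ℝ} (h0 : 0 ≤ θ) (h1 : θ ≤ 1) (hs : 0 ≤ s) :
    orliczA (θ * s) ≤ θ * orliczA s := by
  have := convexOn_orliczA.2 (x := s) (y := 0) hs (mem_Ici.2 le_rfl) h0 (sub_nonneg.2 h1)
    (by ring)
  simpa [orliczA_zero] using this

theorem orliczA_mono {s t : ℝ} (hs : 0 ≤ s) (hst : s ≤ t) : orliczA s ≤ orliczA t := by
  rcases hs.eq_or_lt with rfl | hs0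
  · rw [orliczA_zero]; exact orliczA_nonneg hst
  have ht : 0 < t := hs0.trans_le hst
  have h := orliczA_mul_le (θ := s / t) (s := t) (by positivity) ((div_le_one ht).2 hst) ht.le
  rw [div_mul_cancel₀ _ ht.ne'] at h
  exact h.trans (mul_le_of_le_one_left (orliczA_nonneg ht.le) ((div_le_one ht).2 hst))

/-- `A(k s) ≤ k² A(s)` for `k ≥ 1`. -/
theorem orliczA_mul_le_sq {k s : ℝ} (hk : 1 ≤ k) (hs : 0 ≤ s) :
    orliczA (k * s) ≤ k ^ 2 * orliczA s := by
  rcases hs.eq_or_lt with rfl | hs0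
  · simp [orliczA_zero]
  have hk0 : 0 < k := by linarith
  have hsk : s ≤ k * s := le_mul_of_one_le_left hs hk
  have hc := Real.exp_pos (-3)
  rcases le_total (k * s) (Real.exp (-3)) with h | h
  · rw [orliczA, orliczA, if_pos h, if_pos (hsk.trans h)]
    have : Real.log (s ^ 2) ≤ Real.log ((k * s) ^ 2) :=
      Real.log_le_log (by positivity) (pow_le_pow_left₀ hs hsk 2)
    nlinarith [mul_le_mul_of_nonneg_left this (by positivity : 0 ≤ k ^ 2 * s ^ 2)]
  · rcases le_total s (Real.exp (-3)) with h' | h'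
    · rw [orliczA_eq_right h, exp_neg_six]
      have h1 := log_sq_le hs0 h'
      rw [orliczA, if_pos h']
      have h2 := mul_le_mul_of_nonneg_left h1 (by positivity : 0 ≤ k ^ 2 * s ^ 2)
      nlinarith [mul_nonneg (sub_nonneg.2 h) (by linarith : 0 ≤ 3 * (k * s) - Real.exp (-3))]
    · rw [orliczA_eq_right h, orliczA_eq_right h', exp_neg_six]
      have h1 : 0 ≤ 4 * (k * s) - Real.exp (-3) * (k + 1) := by
        nlinarith [mul_le_mul_of_nonneg_left h' hk0.le]
      nlinarith [mul_nonneg (mul_nonneg hc.le (sub_nonneg.2 hk)) h1]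

theorem MemLA.aestronglyMeasurable {f : ℝ → ℂ} (hf : MemLA f) :
    AEStronglyMeasurable f (volume.restrict (Ioi 0)) := hf.1.aestronglyMeasurable

theorem memLA_of_le {f : ℝ → ℂ} {G : ℝ → ℝ} (hf : LocallyIntegrableOn f (Ioi 0))
    (hG : IntegrableOn G (Ioi 0)) (h : ∀ x, orliczA ‖f x‖ ≤ G x) : MemLA f := by
  refine ⟨hf, hG.mono' (continuous_orliczA.comp_aestronglyMeasurable
    hf.aestronglyMeasurable.norm) (ae_of_all _ fun x => ?_)⟩
  rw [Real.norm_of_nonneg (orliczA_nonneg (norm_nonneg _))]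
  exact h x

theorem MemLA.smul {f : ℝ → ℂ} (c : ℂ) (hf : MemLA f) : MemLA (c • f) := by
  refine memLA_of_le (hf.1.smul c) (hf.2.const_mul ((‖c‖ + 1) ^ 2)) fun x => ?_
  rw [Pi.smul_apply, norm_smul]
  have h0 := norm_nonneg (f x)
  have h1 := norm_nonneg c
  exact (orliczA_mono (by positivity) (mul_le_mul_of_nonneg_right (by linarith) h0)).trans
    (orliczA_mul_le_sq (by linarith) h0)

theorem MemLA.add {f g : ℝ → ℂ} (hf : MemLA f) (hg : MemLA g) : MemLA (f + g) := by
  refine memLA_of_le (hf.1.add hg.1) ((hf.2.const_mul 4).add (hg.2.const_mul 4)) fun x => ?_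
  have h0 := norm_nonneg (f x)
  have h1 := norm_nonneg (g x)
  have h2 := norm_add_le (f x) (g x)
  have a0 := orliczA_nonneg h0
  have a1 := orliczA_nonneg h1
  simp only [Pi.add_apply]
  rcases le_total ‖f x‖ ‖g x‖ with h | h
  · have b1 := orliczA_mono (norm_nonneg _) (by linarith : ‖f x + g x‖ ≤ 2 * ‖g x‖)
    have b2 := orliczA_mul_le_sq (by norm_num : (1 : ℝ) ≤ 2) h1
    linarith
  · have b1 := orliczA_mono (norm_nonneg _) (by linarith : ‖f x + g x‖ ≤ 2 * ‖f x‖)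
    have b2 := orliczA_mul_le_sq (by norm_num : (1 : ℝ) ≤ 2) h0
    linarith

theorem memLA_zero : MemLA (0 : ℝ → ℂ) := by
  refine ⟨locallyIntegrable_zero.locallyIntegrableOn _, ?_⟩
  simp [orliczA_zero]

/-- The set of admissible numbers in the definition of the Luxemburg norm. -/
def luxSet (f : ℝ → ℂ) : Set ℝ :=
  {k : ℝ | 0 < k ∧ ∫⁻ x in Ioi 0, ENNReal.ofReal (orliczA (k⁻¹ * ‖f x‖)) ≤ 1}

theorem luxSet_bddBelow (f : ℝ → ℂ) : BddBelow (luxSet f) := ⟨0, fun _ hk => hk.1.le⟩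

theorem luxNorm_nonneg (f : ℝ → ℂ) : 0 ≤ luxNorm f := Real.sInf_nonneg fun _ hk => hk.1.le

theorem luxSet_nonempty {f : ℝ → ℂ} (hf : MemLA f) : (luxSet f).Nonempty := by
  set I : ℝ := ∫ x in Ioi 0, orliczA ‖f x‖ with hI
  have hI0 : 0 ≤ I := integral_nonneg fun x => orliczA_nonneg (norm_nonneg _)
  have hk : 0 < I + 1 := by linarith
  refine ⟨I + 1, hk, ?_⟩
  have h1 : (I + 1)⁻¹ ≤ 1 := inv_le_one_of_one_le₀ (by linarith)
  have h0 : 0 ≤ (I + 1)⁻¹ := by positivity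
  calc ∫⁻ x in Ioi 0, ENNReal.ofReal (orliczA ((I + 1)⁻¹ * ‖f x‖))
      ≤ ∫⁻ x in Ioi 0, ENNReal.ofReal ((I + 1)⁻¹ * orliczA ‖f x‖) :=
        lintegral_mono fun x => ENNReal.ofReal_le_ofReal
          (orliczA_mul_le h0 h1 (norm_nonneg _))
    _ = ENNReal.ofReal (∫ x in Ioi 0, (I + 1)⁻¹ * orliczA ‖f x‖) :=
        (ofReal_integral_eq_lintegral_ofReal (hf.2.const_mul _)
          (ae_of_all _ fun x => mul_nonneg h0 (orliczA_nonneg (norm_nonneg _)))).symm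
    _ ≤ 1 := by
        rw [integral_const_mul, ← hI]
        refine ENNReal.ofReal_le_one.2 ?_
        rw [inv_mul_le_iff₀ hk]; linarith

open Pointwise in
theorem luxSet_smul {c : ℂ} (hc : c ≠ 0) (f : ℝ → ℂ) : luxSet (c • f) = ‖c‖ • luxSet f := by
  have hc' : 0 < ‖c‖ := norm_pos_iff.2 hc
  ext k
  rw [Set.mem_smul_set_iff_inv_smul_mem₀ hc'.ne']
  simp only [luxSet, mem_ofPred_eq, smul_eq_mul, Pi.smul_apply, norm_mul]
  have h1 : 0 < ‖c‖⁻¹ * k ↔ 0 < k := by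
    constructor
    · intro h; exact pos_of_mul_pos_right h (by positivity)
    · intro h; positivity
  have h2 : ∀ x, k⁻¹ * (‖c‖ * ‖f x‖) = (‖c‖⁻¹ * k)⁻¹ * ‖f x‖ := by
    intro x; rw [mul_inv, inv_inv]; ring
  simp only [h1, h2]

theorem luxNorm_zero : luxNorm 0 = 0 := by
  refine le_antisymm (le_of_forall_pos_le_add fun ε hε => ?_) (luxNorm_nonneg _)
  refine csInf_le (luxSet_bddBelow 0) ?_
  simp [hε, orliczA_zero]

open Pointwise in
theorem luxNorm_smul (c : ℂ) (f : ℝ → ℂ) : luxNorm (c • f) = ‖c‖ * luxNorm f := by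
  rcases eq_or_ne c 0 with rfl | hc
  · simp [luxNorm_zero]
  · change sInf (luxSet (c • f)) = ‖c‖ * sInf (luxSet f)
    rw [luxSet_smul hc, Real.sInf_smul_of_nonneg (norm_nonneg c), smul_eq_mul]

theorem luxSet_add {f g : ℝ → ℂ} (hf : MemLA f) {k l : ℝ} (hk : k ∈ luxSet f)
    (hl : l ∈ luxSet g) : k + l ∈ luxSet (f + g) := by
  obtain ⟨hk0, hk1⟩ := hk
  obtain ⟨hl0, hl1⟩ := hl
  have hkl : 0 < k + l := by linarith
  refine ⟨hkl, ?_⟩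
  set θ : ℝ := k / (k + l) with hθ
  set η : ℝ := l / (k + l) with hη
  have hθ0 : 0 ≤ θ := by positivity
  have hη0 : 0 ≤ η := by positivity
  have hs : θ + η = 1 := by rw [hθ, hη]; field_simp
  have hpt : ∀ x, orliczA ((k + l)⁻¹ * ‖(f + g) x‖)
      ≤ θ * orliczA (k⁻¹ * ‖f x‖) + η * orliczA (l⁻¹ * ‖g x‖) := by
    intro x
    have hc := convexOn_orliczA.2 (x := k⁻¹ * ‖f x‖) (y := l⁻¹ * ‖g x‖)
      (mem_Ici.2 (by positivity)) (mem_Ici.2 (by positivity)) hθ0 hη0 hs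
    refine (orliczA_mono (by positivity) ?_).trans hc
    have e : θ • (k⁻¹ * ‖f x‖) + η • (l⁻¹ * ‖g x‖) = (k + l)⁻¹ * (‖f x‖ + ‖g x‖) := by
      simp only [smul_eq_mul, hθ, hη]; field_simp
    rw [e]
    exact mul_le_mul_of_nonneg_left (norm_add_le _ _) (by positivity)
  have hm : AEMeasurable (fun x => ENNReal.ofReal (orliczA (k⁻¹ * ‖f x‖)))
      (volume.restrict (Ioi 0)) :=
    ENNReal.measurable_ofReal.comp_aemeasurable (continuous_orliczA.measurable.comp_aemeasurable
      (hf.aestronglyMeasurable.norm.aemeasurable.const_mul _))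
  calc ∫⁻ x in Ioi 0, ENNReal.ofReal (orliczA ((k + l)⁻¹ * ‖(f + g) x‖))
      ≤ ∫⁻ x in Ioi 0, (ENNReal.ofReal θ * ENNReal.ofReal (orliczA (k⁻¹ * ‖f x‖))
          + ENNReal.ofReal η * ENNReal.ofReal (orliczA (l⁻¹ * ‖g x‖))) := by
        refine lintegral_mono fun x => ?_
        rw [← ENNReal.ofReal_mul hθ0, ← ENNReal.ofReal_mul hη0, ← ENNReal.ofReal_add
          (mul_nonneg hθ0 (orliczA_nonneg (by positivity)))
          (mul_nonneg hη0 (orliczA_nonneg (by positivity)))]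
        exact ENNReal.ofReal_le_ofReal (hpt x)
    _ = ENNReal.ofReal θ * (∫⁻ x in Ioi 0, ENNReal.ofReal (orliczA (k⁻¹ * ‖f x‖)))
          + ENNReal.ofReal η * ∫⁻ x in Ioi 0, ENNReal.ofReal (orliczA (l⁻¹ * ‖g x‖)) := by
        rw [lintegral_add_left' (hm.const_mul _), lintegral_const_mul' _ _ ENNReal.ofReal_ne_top,
          lintegral_const_mul' _ _ ENNReal.ofReal_ne_top]
    _ ≤ ENNReal.ofReal θ * 1 + ENNReal.ofReal η * 1 := by gcongr
    _ = 1 := by rw [mul_one, mul_one, ← ENNReal.ofReal_add hθ0 hη0, hs, ENNReal.ofReal_one]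

theorem luxNorm_add_le {f g : ℝ → ℂ} (hf : MemLA f) (hg : MemLA g) :
    luxNorm (f + g) ≤ luxNorm f + luxNorm g := by
  refine le_of_forall_pos_le_add fun ε hε => ?_
  obtain ⟨k, hk, hk'⟩ := exists_lt_of_csInf_lt (luxSet_nonempty hf)
    (show sInf (luxSet f) < luxNorm f + ε / 2 from lt_add_of_pos_right _ (half_pos hε))
  obtain ⟨l, hl, hl'⟩ := exists_lt_of_csInf_lt (luxSet_nonempty hg)
    (show sInf (luxSet g) < luxNorm g + ε / 2 from lt_add_of_pos_right _ (half_pos hε))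
  have : luxNorm (f + g) ≤ k + l := csInf_le (luxSet_bddBelow _) (luxSet_add hf hk hl)
  linarith

theorem h1Norm_nonneg (f : ℝ → ℂ) : 0 ≤ h1Norm f := Real.sqrt_nonneg _

theorem wHalfNorm_nonneg (f : ℝ → ℂ) : 0 ≤ wHalfNorm f :=
  add_nonneg (h1Norm_nonneg f) (luxNorm_nonneg f)

theorem wHalfNorm_add_le {f g : ℝ → ℂ} (hf : MemWHalf f) (hg : MemWHalf g) :
    wHalfNorm (f + g) ≤ wHalfNorm f + wHalfNorm g := by
  have h1 := h1Norm_add_le hf.1 hg.1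
  have h2 := luxNorm_add_le hf.2 hg.2
  simp only [wHalfNorm]; linarith

theorem wHalfNorm_smul {f : ℝ → ℂ} (c : ℂ) (hf : MemWHalf f) :
    wHalfNorm (c • f) = ‖c‖ * wHalfNorm f := by
  rw [wHalfNorm, h1Norm_smul c hf.1, luxNorm_smul, wHalfNorm, mul_add]

/-! ### The star graph with `N` edges and the energy space `W(Γ)` -/

/-- The restriction of a function on the graph to the edge `J_e = (0, ∞)`. A function on the graph
is given by its restrictions to the closed edges `[0, ∞)`, the point `0` of each closed edge being
the central vertex. (Only the values for `x > 0` matter here.) -/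
def edge {N : ℕ} (u : Fin N → C(ℝ≥0, ℂ)) (e : Fin N) : ℝ → ℂ := fun x => u e x.toNNReal

/-- `W(Γ)` as a set of functions: `u` is continuous on the graph (on each edge and at the central
vertex), and each `u_e` lies in `W(ℝ⁺) = H¹(ℝ⁺) ∩ L^A(ℝ⁺)`. -/
def energySubmodule (N : ℕ) : Submodule ℂ (Fin N → C(ℝ≥0, ℂ)) where
  carrier := {u | (∀ e r, u e 0 = u r 0) ∧ ∀ e, MemWHalf (edge u e)}
  add_mem' {u v} hu hv := ⟨fun e r => by simp [hu.1 e r, hv.1 e r], fun e =>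
    ⟨(hu.2 e).1.add (hv.2 e).1, (hu.2 e).2.add (hv.2 e).2⟩⟩
  zero_mem' := ⟨fun _ _ => rfl, fun _ => ⟨memH1_zero, memLA_zero⟩⟩
  smul_mem' c u hu := ⟨fun e r => by simp [hu.1 e r], fun e =>
    ⟨(hu.2 e).1.smul c, (hu.2 e).2.smul c⟩⟩

/-- The energy space `W(Γ)`. -/
def W (N : ℕ) : Type := energySubmodule N

instance (N : ℕ) : AddCommGroup (W N) := inferInstanceAs (AddCommGroup (energySubmodule N))

instance (N : ℕ) : Module ℂ (W N) := inferInstanceAs (Module ℂ (energySubmodule N))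

/-- The restriction `u_e` of `u ∈ W(Γ)` to the edge `e`. -/
def W.on {N : ℕ} (u : W N) (e : Fin N) : ℝ → ℂ := edge u.1 e

/-- The weak derivative of `u ∈ W(Γ)` on the edge `e`. -/
def W.deriv {N : ℕ} (u : W N) (e : Fin N) : ℝ → ℂ := weakDeriv (u.on e)

/-- The value of `u ∈ W(Γ)` at the central vertex. -/
def W.vertex {N : ℕ} [NeZero N] (u : W N) : ℂ := u.1 0 0

theorem W.mem {N : ℕ} (u : W N) (e : Fin N) : MemWHalf (u.on e) := u.2.2 e

theorem W.on_add {N : ℕ} (u v : W N) (e : Fin N) : (u + v).on e = u.on e + v.on e := rfl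

theorem W.on_smul {N : ℕ} (c : ℂ) (u : W N) (e : Fin N) : (c • u).on e = c • u.on e := rfl

/-- The norm of `W(Γ)`: `‖u‖² = ∑_e ‖u_e‖²_{W(ℝ⁺)}`. -/
instance (N : ℕ) : Norm (W N) := ⟨fun u => √(∑ e, wHalfNorm (u.on e) ^ 2)⟩

theorem W.norm_def {N : ℕ} (u : W N) : ‖u‖ = √(∑ e, wHalfNorm (u.on e) ^ 2) := rfl

theorem eq_zero_of_l2Norm_eq_zero (f : C(ℝ≥0, ℂ))
    (hf : MemLp (fun x : ℝ => f x.toNNReal) 2 (volume.restrict (Ioi 0)))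
    (h : l2Norm (fun x : ℝ => f x.toNNReal) = 0) : f = 0 := by
  rw [l2Norm, ENNReal.toReal_eq_zero_iff, or_iff_left hf.2.ne,
    eLpNorm_eq_zero_iff hf.1 (by norm_num)] at h
  have hc : Continuous (fun x : ℝ => f x.toNNReal) := by fun_prop
  have h1 : EqOn (fun x : ℝ => f x.toNNReal) 0 (Ioi 0) :=
    Measure.eqOn_open_of_ae_eq h isOpen_Ioi hc.continuousOn continuousOn_const
  have h2 : EqOn (fun x : ℝ => f x.toNNReal) 0 (closure (Ioi 0)) :=
    h1.closure hc continuous_const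
  ext x
  have := h2 (x := (x : ℝ)) (by rw [closure_Ioi]; exact x.2)
  simpa using this

theorem W.core (N : ℕ) : NormedSpace.Core ℂ (W N) where
  norm_nonneg _ := Real.sqrt_nonneg _
  norm_smul c u := by
    simp only [W.norm_def, W.on_smul, wHalfNorm_smul c (u.mem _), mul_pow]
    rw [← Finset.mul_sum, Real.sqrt_mul (by positivity), Real.sqrt_sq (norm_nonneg c)]
  norm_triangle u v := by
    simp only [W.norm_def, W.on_add]
    refine (Real.sqrt_le_sqrt (Finset.sum_le_sum fun e _ => ?_)).trans
      (sqrt_sum_add_sq_le (fun e => wHalfNorm (u.on e)) (fun e => wHalfNorm (v.on e)))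
    exact pow_le_pow_left₀ (wHalfNorm_nonneg _) (wHalfNorm_add_le (u.mem e) (v.mem e)) 2
  norm_eq_zero_iff u := by
    constructor
    · intro h
      rw [W.norm_def, Real.sqrt_eq_zero (Finset.sum_nonneg fun _ _ => sq_nonneg _),
        Finset.sum_eq_zero_iff_of_nonneg (fun _ _ => sq_nonneg _)] at h
      refine Subtype.ext (funext fun e => ?_)
      have h1 : wHalfNorm (u.on e) = 0 := pow_eq_zero_iff two_ne_zero |>.1 (h e (Finset.mem_univ e))
      have h2 : h1Norm (u.on e) = 0 := by
        have := h1Norm_nonneg (u.on e)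
        have := luxNorm_nonneg (u.on e)
        rw [wHalfNorm] at h1
        linarith
      rw [h1Norm, Real.sqrt_eq_zero (by positivity)] at h2
      refine eq_zero_of_l2Norm_eq_zero _ (u.mem e).1.1 ?_
      have : l2Norm (u.on e) ^ 2 = 0 := by
        nlinarith [sq_nonneg (l2Norm (u.on e)), sq_nonneg (l2Norm (weakDeriv (u.on e)))]
      exact pow_eq_zero_iff two_ne_zero |>.1 this
    · rintro rfl
      have h0 : (0 : W N) = (0 : ℂ) • (0 : W N) := by simp
      rw [W.norm_def, Real.sqrt_eq_zero (Finset.sum_nonneg fun _ _ => sq_nonneg _)]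
      refine Finset.sum_eq_zero fun e _ => ?_
      rw [h0, W.on_smul, wHalfNorm_smul _ (W.mem _ _)]
      simp

instance (N : ℕ) : NormedAddCommGroup (W N) := NormedAddCommGroup.ofCore (W.core N)

instance (N : ℕ) : NormedSpace ℂ (W N) := NormedSpace.ofCore (W.core N)

/-- The dual space `W'(Γ)`. As `L²` carries the real scalar product `Re ∫ u v̄`, it consists of the
continuous real-linear functionals. -/
abbrev W' (N : ℕ) : Type := W N →L[ℝ] ℝ

/-! ### The quadratic form, the energy and elements of `W'(Γ)` -/

/-- The quadratic form `𝔉_γ[u] = ∑_e ∫ |u_e'|² dx - γ |u(0)|²`. -/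
def quadForm {N : ℕ} [NeZero N] (γ : ℝ) (u : W N) : ℝ :=
  (∑ e, ∫ x in Ioi 0, ‖u.deriv e x‖ ^ 2) - γ * ‖u.vertex‖ ^ 2

/-- The real bilinear form `𝔉_γ[u, v]` of the quadratic form `𝔉_γ`. -/
def bilinForm {N : ℕ} [NeZero N] (γ : ℝ) (u v : W N) : ℝ :=
  (∑ e, ∫ x in Ioi 0, (u.deriv e x * conj (v.deriv e x)).re) - γ * (u.vertex * conj v.vertex).re

/-- The energy `E(u) = ½ 𝔉_γ[u] - ½ ∫_Γ |u|² Log |u|² dx`. -/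
def energy {N : ℕ} [NeZero N] (γ : ℝ) (u : W N) : ℝ :=
  1 / 2 * quadForm γ u - 1 / 2 * ∑ e, ∫ x in Ioi 0, ‖u.on e x‖ ^ 2 * Real.log (‖u.on e x‖ ^ 2)

/-- `T ∈ W'(Γ)` is the functional `-Δ_γ u`, that is, `⟨-Δ_γ u, v⟩ = 𝔉_γ[u, v]` for all `v`. -/
def IsNegLaplacian {N : ℕ} [NeZero N] (γ : ℝ) (u : W N) (T : W' N) : Prop :=
  ∀ v : W N, T v = bilinForm γ u v

/-- `T ∈ W'(Γ)` is the functional given by the function `f = (f_e)` on the graph: for all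
`v ∈ W(Γ)` the products `f_e v̄_e` are integrable and `⟨T, v⟩ = Re ∫_Γ f v̄ dx`. -/
def IsGivenBy {N : ℕ} (f : Fin N → ℝ → ℂ) (T : W' N) : Prop :=
  ∀ v : W N, (∀ e, IntegrableOn (fun x => f e x * conj (v.on e x)) (Ioi 0)) ∧
    T v = ∑ e, ∫ x in Ioi 0, (f e x * conj (v.on e x)).re

/-- The function `u Log |u|²` on the graph, defined edge by edge. -/
def logTerm {N : ℕ} (u : W N) (e : Fin N) : ℝ → ℂ :=
  fun x => u.on e x * (Real.log (‖u.on e x‖ ^ 2) : ℂ)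

end

end StarGraph

namespace StarGraph

/-! ### Scalar inequalities for the logarithmic nonlinearity -/

/-! The energy is half a continuous quadratic form minus the logarithmic part, and the form is
harmless: weak derivatives map into `L²`, and the vertex value is bounded by the Sobolev embedding.
All the work is in the logarithmic part, where explicit bounds with the modulus `ω(s) = s (1 + |Log
s|)` (`logModulus`) replace any convergence theorem.

Pointwise, on a disc of radius `M`, the map `z Log |z|²` has modulus of continuity `ω`
(`norm_logMap_sub_le`), and `|z|² Log |z|²` has first order Taylor remainder at most a constant
times `ω(|w|) |w|` (`abs_logDensity_add_sub_le`). The Sobolev embedding (`exists_norm_le_h1Norm`)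
supplies the radius.

The integral estimate `∫ ω(|u_e|) |v_e| ≤ C ω(‖u‖) ‖v‖` (`W.exists_integral_logModulus_mul_le`)
turns these bounds into bounds in `W(Γ)`. On the unit ball it holds because `ω(s) t` is dominated by
`A(s) + A(t)` for bounded `s`, `t`, while the Luxemburg norm controls `∫ A`. Submultiplicativity of
`ω` then extends it to all of `W(Γ)`.

Hence the Taylor remainder of the logarithmic part is `O(ω(‖w‖) ‖w‖) = o(‖w‖)`, which gives
differentiability, and the derivative changes by `O(ω(‖w - u‖))` near `u`, which gives continuity of
the derivative. -/

/-- The modulus of continuity `s (1 + |Log s|)` of the logarithmic nonlinearity. -/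
noncomputable def logModulus (s : ℝ) : ℝ := s * (1 + |Real.log s|)

/-- The nonlinearity `z Log |z|²`. -/
noncomputable def logMap (z : ℂ) : ℂ := z * (Real.log (‖z‖ ^ 2) : ℂ)

/-- The density `|z|² Log |z|²`. -/
noncomputable def logDensity (z : ℂ) : ℝ := ‖z‖ ^ 2 * Real.log (‖z‖ ^ 2)

theorem logModulus_zero : logModulus 0 = 0 := by simp [logModulus]

theorem logModulus_nonneg {s : ℝ} (hs : 0 ≤ s) : 0 ≤ logModulus s := by
  unfold logModulus; positivity

theorem le_logModulus {s : ℝ} (hs : 0 ≤ s) : s ≤ logModulus s := by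
  unfold logModulus; nlinarith [abs_nonneg (Real.log s)]

/-- The product `s |Log s|` is `|s Log s|` up to the sign of `s`, so the singularity of the
logarithm at `0` is removable. Continuity at `0` is what later turns bounds by `ω` into limits. -/
theorem continuous_logModulus : Continuous logModulus := by
  have h : logModulus = fun s => s + s * |Real.log s| := by
    ext s; unfold logModulus; ring
  have h2 : ∀ s : ℝ, s * |Real.log s| = (if 0 ≤ s then 1 else -1) * |s * Real.log s| := by
    intro s
    split_ifs with hs
    · rw [abs_mul, abs_of_nonneg hs, one_mul]
    · rw [abs_mul, abs_of_neg (not_le.1 hs)]; ring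
  rw [h]
  refine continuous_id.add ?_
  simp_rw [h2, ite_mul]
  refine Continuous.if_le ?_ ?_ continuous_const continuous_id ?_
  · exact continuous_const.mul Real.continuous_mul_log.abs
  · exact continuous_const.mul Real.continuous_mul_log.abs
  · rintro s rfl; simp

/-- With `s = θ d`, the logarithm splits into `Log θ + Log d`, and `θ |Log θ| ≤ 2` on `(0, 2]`. This
serves both as monotonicity and as a doubling property, up to a constant. -/
theorem logModulus_le_of_le_two_mul {s d : ℝ} (hs : 0 ≤ s) (h : s ≤ 2 * d) :
    logModulus s ≤ 4 * logModulus d := by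
  have hd0 : 0 ≤ d := by linarith
  rcases hs.eq_or_lt with rfl | hs0
  · rw [logModulus_zero]; linarith [logModulus_nonneg hd0]
  have hd : 0 < d := by linarith
  obtain ⟨θ, rfl⟩ : ∃ θ, s = θ * d := ⟨s / d, by field_simp⟩
  have hθ : 0 < θ := pos_of_mul_pos_left hs0 hd0
  have hθ2 : θ ≤ 2 := le_of_mul_le_mul_right h hd
  have hlog : θ * |Real.log θ| ≤ 2 := by
    rcases le_total θ 1 with h1 | h1
    · have := Real.abs_log_mul_self_lt θ hθ h1
      rw [abs_mul, abs_of_pos hθ] at this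
      linarith
    · rw [abs_of_nonneg (Real.log_nonneg h1)]
      have := Real.log_le_sub_one_of_pos hθ
      nlinarith [Real.log_nonneg h1]
  unfold logModulus
  rw [Real.log_mul hθ.ne' hd.ne']
  have h1 := abs_add_le (Real.log θ) (Real.log d)
  have h2 : 0 ≤ |Real.log d| := abs_nonneg _
  have h3 := mul_le_mul_of_nonneg_left h1 hs
  have h4 : d * (θ * |Real.log θ|) ≤ d * 2 := mul_le_mul_of_nonneg_left hlog hd0
  have h5 : θ * (d * (1 + |Real.log d|)) ≤ 2 * (d * (1 + |Real.log d|)) :=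
    mul_le_mul_of_nonneg_right hθ2 (by positivity)
  nlinarith [mul_nonneg hd0 h2]

/-- Submultiplicativity comes from `1 + |x + y| ≤ (1 + |x|)(1 + |y|)`. It lets estimates on the unit
ball of `W(Γ)` be rescaled. -/
theorem logModulus_mul_le {ε s : ℝ} (hε : 0 ≤ ε) (hs : 0 ≤ s) :
    logModulus (ε * s) ≤ logModulus ε * logModulus s := by
  rcases hε.eq_or_lt with rfl | hε0
  · simp [logModulus_zero]
  rcases hs.eq_or_lt with rfl | hs0
  · simp [logModulus_zero]
  unfold logModulus
  rw [Real.log_mul hε0.ne' hs0.ne']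
  have h1 := abs_add_le (Real.log ε) (Real.log s)
  have h2 : 1 + |Real.log ε + Real.log s| ≤ (1 + |Real.log ε|) * (1 + |Real.log s|) := by
    nlinarith [mul_nonneg (abs_nonneg (Real.log ε)) (abs_nonneg (Real.log s))]
  calc ε * s * (1 + |Real.log ε + Real.log s|)
      ≤ ε * s * ((1 + |Real.log ε|) * (1 + |Real.log s|)) := by gcongr
    _ = _ := by ring

theorem abs_log_le_add {a x b : ℝ} (ha : 0 < a) (h1 : a ≤ x) (h2 : x ≤ b) :
    |Real.log x| ≤ |Real.log a| + |Real.log b| := by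
  have := abs_le_max_abs_abs (Real.log_le_log ha h1) (Real.log_le_log (ha.trans_le h1) h2)
  exact this.trans (max_le_add_of_nonneg (abs_nonneg _) (abs_nonneg _))

/-- Below `e⁻³` one has `|Log r| ≥ 3`, so `1 + |Log r| ≤ 2 |Log r|` and the left side is at most
`A(r)` itself. On `[e⁻³, M]` one has `|Log r| ≤ 3 + |Log M|` and `r² ≤ A(r)`. -/
theorem logModulus_mul_self_le_orliczA {M r : ℝ} (hr : 0 ≤ r) (hM : r ≤ M) :
    logModulus r * r ≤ (4 + |Real.log M|) * orliczA r := by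
  rcases hr.eq_or_lt with rfl | hr0
  · simp [orliczA_zero]
  have hA := orliczA_nonneg hr
  have hL := abs_nonneg (Real.log M)
  have hc := Real.exp_pos (-3)
  rcases le_total r (Real.exp (-3)) with h | h
  · have h1 := log_sq_le hr0 h
    have e : logModulus r * r ≤ orliczA r := by
      rw [orliczA, if_pos h, logModulus]
      rw [Real.log_pow] at *
      push_cast at *
      rw [abs_of_neg (by linarith)]
      nlinarith [mul_nonneg (sq_nonneg r) (by linarith : 0 ≤ -3 - Real.log r)]
    nlinarith
  · have h1 := abs_log_le_add hc h hM
    rw [Real.log_exp] at h1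
    norm_num at h1
    have h2 : r ^ 2 ≤ orliczA r := by
      rw [orliczA_eq_right h, exp_neg_six]; nlinarith
    have h3 : logModulus r * r ≤ (4 + |Real.log M|) * r ^ 2 := by
      unfold logModulus
      nlinarith [mul_le_mul_of_nonneg_left h1 (sq_nonneg r)]
    exact h3.trans (mul_le_mul_of_nonneg_left h2 (by positivity))

/-- A Young type inequality, reduced to the diagonal case at the larger of `s` and `t`. -/
theorem logModulus_mul_le_orliczA {M s t : ℝ} (hs : 0 ≤ s) (hsM : s ≤ M) (ht : 0 ≤ t)
    (htM : t ≤ M) :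
    logModulus s * t ≤ 4 * (4 + |Real.log M|) * (orliczA s + orliczA t) := by
  have hL := abs_nonneg (Real.log M)
  have as := mul_nonneg (by positivity : 0 ≤ 4 + |Real.log M|) (orliczA_nonneg hs)
  have at' := mul_nonneg (by positivity : 0 ≤ 4 + |Real.log M|) (orliczA_nonneg ht)
  rcases le_total s t with h | h
  · have h1 := mul_le_mul_of_nonneg_right
      (logModulus_le_of_le_two_mul hs (by linarith : s ≤ 2 * t)) ht
    have h2 := logModulus_mul_self_le_orliczA ht htM
    nlinarith
  · have h1 := mul_le_mul_of_nonneg_left h (logModulus_nonneg hs)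
    have h2 := logModulus_mul_self_le_orliczA hs hsM
    nlinarith

theorem norm_logMap (z : ℂ) : ‖logMap z‖ = 2 * (‖z‖ * |Real.log ‖z‖|) := by
  rw [logMap, norm_mul, Complex.norm_real, Real.log_pow, Real.norm_eq_abs, abs_mul]
  norm_num
  ring

theorem norm_logMap_le (z : ℂ) : ‖logMap z‖ ≤ 2 * logModulus ‖z‖ := by
  rw [norm_logMap, logModulus]
  nlinarith [norm_nonneg z]

theorem abs_logDensity_le (z : ℂ) : |logDensity z| ≤ 2 * (logModulus ‖z‖ * ‖z‖) := by
  have : |logDensity z| = ‖logMap z‖ * ‖z‖ := by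
    rw [logDensity, logMap, norm_mul, Complex.norm_real, abs_mul, abs_of_nonneg (by positivity),
      Real.norm_eq_abs]
    ring
  rw [this]
  nlinarith [mul_le_mul_of_nonneg_right (norm_logMap_le z) (norm_nonneg z)]

theorem measurable_logMap : Measurable logMap := by
  unfold logMap; fun_prop

theorem measurable_logDensity : Measurable logDensity := by
  unfold logDensity; fun_prop

theorem norm_logMap_sub_le_of_norm_le {M : ℝ} {z w : ℂ} (hzw : ‖z‖ ≤ ‖w‖) (hw : ‖w‖ ≤ M) :
    ‖logMap z - logMap w‖ ≤ (4 + 2 * |Real.log M|) * logModulus ‖z - w‖ := by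
  rcases eq_or_ne z w with rfl | hne
  · simp [logModulus_zero]
  have hd : 0 < ‖z - w‖ := norm_pos_iff.2 (sub_ne_zero.2 hne)
  have hd2 : ‖z - w‖ ≤ 2 * ‖w‖ := (norm_sub_le z w).trans (by linarith)
  have hw0 : 0 < ‖w‖ := by linarith
  -- The logarithm of the larger modulus is paired with `z - w`: its size is controlled since `‖z -
  -- w‖ / 2 ≤ ‖w‖ ≤ M`. The other term is Lipschitz, because `‖z‖ Log (‖w‖ / ‖z‖) ≤ ‖w‖ - ‖z‖`.
  have e : logMap z - logMap w = (z - w) * (Real.log (‖w‖ ^ 2) : ℂ)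
      + z * ((Real.log (‖z‖ ^ 2) - Real.log (‖w‖ ^ 2) : ℝ) : ℂ) := by
    unfold logMap; push_cast; ring
  have h1 : ‖(z - w) * (Real.log (‖w‖ ^ 2) : ℂ)‖
      ≤ 2 * ‖z - w‖ * (|Real.log ‖z - w‖| + 1 + |Real.log M|) := by
    have h2 := abs_log_le_add (half_pos hd) (by linarith : ‖z - w‖ / 2 ≤ ‖w‖) hw
    have h3 : |Real.log (‖z - w‖ / 2)| ≤ |Real.log ‖z - w‖| + 1 := by
      rw [Real.log_div hd.ne' two_ne_zero]
      refine (abs_sub _ _).trans (add_le_add le_rfl ?_)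
      rw [abs_of_nonneg (Real.log_nonneg one_le_two)]
      linarith [Real.log_two_lt_d9]
    rw [norm_mul, Complex.norm_real, Real.log_pow, Real.norm_eq_abs, abs_mul]
    norm_num
    nlinarith
  have h4 : ‖z * ((Real.log (‖z‖ ^ 2) - Real.log (‖w‖ ^ 2) : ℝ) : ℂ)‖ ≤ 2 * ‖z - w‖ := by
    rcases eq_or_ne z 0 with rfl | hz
    · simp
    have hz0 : 0 < ‖z‖ := norm_pos_iff.2 hz
    have hl := Real.log_le_log hz0 hzw
    have hl2 := Real.log_le_sub_one_of_pos (div_pos hw0 hz0)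
    rw [Real.log_div hw0.ne' hz0.ne'] at hl2
    have hl3 := mul_le_mul_of_nonneg_left hl2 hz0.le
    have e2 : ‖z‖ * (‖w‖ / ‖z‖ - 1) = ‖w‖ - ‖z‖ := by field_simp
    have hl4 := norm_sub_norm_le w z
    rw [norm_sub_rev] at hl4
    rw [norm_mul, Complex.norm_real, Real.log_pow, Real.log_pow, Real.norm_eq_abs]
    push_cast
    rw [abs_of_nonpos (by linarith)]
    nlinarith
  rw [e]
  refine (norm_add_le _ _).trans ((add_le_add h1 h4).trans ?_)
  unfold logModulus
  nlinarith [mul_nonneg hd.le (mul_nonneg (abs_nonneg (Real.log M))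
    (abs_nonneg (Real.log ‖z - w‖))), mul_nonneg hd.le (abs_nonneg (Real.log ‖z - w‖))]

/-- `z Log |z|²` has modulus of continuity `logModulus` on bounded sets. -/
theorem norm_logMap_sub_le {M : ℝ} {z w : ℂ} (hz : ‖z‖ ≤ M) (hw : ‖w‖ ≤ M) :
    ‖logMap z - logMap w‖ ≤ (4 + 2 * |Real.log M|) * logModulus ‖z - w‖ := by
  rcases le_total ‖z‖ ‖w‖ with h | h
  · exact norm_logMap_sub_le_of_norm_le h hw
  · rw [norm_sub_rev, norm_sub_rev z]
    exact norm_logMap_sub_le_of_norm_le h hz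

/-- The quantity inside the absolute value is the first order Taylor remainder of `t Log t` at `a`.
Applying `Log x ≤ x - 1` to `b / a` and to `a / b` bounds it above and shows that it is nonnegative.
-/
theorem abs_mul_log_sub_le {a b : ℝ} (ha : 0 < a) (hb : 0 ≤ b) :
    |b * (Real.log b - Real.log a) - (b - a)| ≤ (b - a) ^ 2 / a := by
  rcases hb.eq_or_lt with rfl | hb0
  · simp [abs_of_pos ha, pow_two, ha.ne']
  have h1 := Real.log_le_sub_one_of_pos (div_pos hb0 ha)
  have h2 := Real.log_le_sub_one_of_pos (div_pos ha hb0)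
  rw [Real.log_div hb0.ne' ha.ne'] at h1
  rw [Real.log_div ha.ne' hb0.ne'] at h2
  have h3 := mul_le_mul_of_nonneg_left h1 hb
  have h4 := mul_le_mul_of_nonneg_left h2 hb
  have e1 : b * (b / a - 1) = (b - a) ^ 2 / a + (b - a) := by field_simp; ring
  have e2 : b * (a / b - 1) = a - b := by field_simp
  rw [abs_of_nonneg (by nlinarith)]
  linarith

/-- First order Taylor estimate for `|z|² Log |z|²`. -/
theorem abs_logDensity_add_sub_le {M : ℝ} {z w : ℂ} (hz : ‖z‖ ≤ M) :
    |logDensity (z + w) - logDensity z - 2 * ((logMap z + z) * conj w).re|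
      ≤ (40 + 2 * |Real.log M|) * (logModulus ‖w‖ * ‖w‖) := by
  have hw := norm_nonneg w
  have hp := mul_nonneg (logModulus_nonneg hw) hw
  have hM := abs_nonneg (Real.log M)
  -- If `‖z‖ ≤ ‖w‖`, no cancellation is needed: the three terms are bounded separately, and `16 + 8
  -- + 2 * 8 = 40`.
  rcases le_or_gt ‖z‖ ‖w‖ with h | h
  · have hzw : ‖z + w‖ ≤ 2 * ‖w‖ := (norm_add_le z w).trans (by linarith)
    have hpz := logModulus_le_of_le_two_mul (norm_nonneg z) (by linarith : ‖z‖ ≤ 2 * ‖w‖)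
    have hpzw := logModulus_le_of_le_two_mul (norm_nonneg _) hzw
    have h1 : |logDensity (z + w)| ≤ 16 * (logModulus ‖w‖ * ‖w‖) := by
      have := mul_le_mul hpzw hzw (norm_nonneg _) (by linarith [logModulus_nonneg hw])
      have := abs_logDensity_le (z + w)
      linarith
    have h2 : |logDensity z| ≤ 8 * (logModulus ‖w‖ * ‖w‖) := by
      have := mul_le_mul hpz h (norm_nonneg _) (by linarith [logModulus_nonneg hw])
      have := abs_logDensity_le z
      linarith
    have h3 : |((logMap z + z) * conj w).re| ≤ 8 * (logModulus ‖w‖ * ‖w‖) := by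
      refine (Complex.abs_re_le_norm _).trans ?_
      rw [norm_mul, RCLike.norm_conj]
      have : ‖logMap z + z‖ ≤ 8 * logModulus ‖w‖ := by
        refine (norm_add_le _ _).trans ?_
        rw [norm_logMap]
        unfold logModulus at *
        nlinarith [norm_nonneg z]
      nlinarith [mul_le_mul_of_nonneg_right this hw]
    rw [abs_le] at *
    constructor <;> nlinarith [h1.1, h1.2, h2.1, h2.2, h3.1, h3.2, mul_nonneg hM hp]
  -- If `‖w‖ < ‖z‖`, the squared moduli `a`, `b` reduce the claim to the remainder of `t Log t` plus
  -- `(Log a + 1) ‖w‖²`. Here `|Log a|` is controlled because `‖w‖ < ‖z‖ ≤ M`.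
  · have hz0 : 0 < ‖z‖ := hw.trans_lt h
    rcases hw.eq_or_lt with hw0 | hw0
    · have : w = 0 := norm_eq_zero.1 hw0.symm
      simp [this, logModulus_zero]
    set a : ℝ := ‖z‖ ^ 2 with ha
    set b : ℝ := ‖z + w‖ ^ 2 with hb
    set q : ℝ := (z * conj w).re with hq
    have hab : b = a + 2 * q + ‖w‖ ^ 2 := by
      rw [ha, hb, hq, ← Complex.normSq_eq_norm_sq, ← Complex.normSq_eq_norm_sq,
        ← Complex.normSq_eq_norm_sq, Complex.normSq_add]
      ring
    have ha0 : 0 < a := by positivity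
    have e : logDensity (z + w) - logDensity z - 2 * ((logMap z + z) * conj w).re
        = (b * (Real.log b - Real.log a) - (b - a)) + (Real.log a + 1) * ‖w‖ ^ 2 := by
      have e1 : ((logMap z + z) * conj w).re = (Real.log a + 1) * q := by
        have : (logMap z + z) * conj w = ((Real.log a + 1 : ℝ) : ℂ) * (z * conj w) := by
          rw [logMap, ← ha]; push_cast; ring
        rw [this, Complex.re_ofReal_mul]
      rw [e1, logDensity, logDensity, ← ha, ← hb]
      linear_combination (Real.log a + 1) * hab
    -- The difference of squares is at most `‖w‖ * 3 ‖z‖` in modulus, hence the factor `9`.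
    have h1 : (b - a) ^ 2 / a ≤ 9 * ‖w‖ ^ 2 := by
      rw [div_le_iff₀ ha0]
      have h2 := abs_norm_sub_norm_le (z + w) z
      rw [add_sub_cancel_left] at h2
      have h3 : ‖z + w‖ + ‖z‖ ≤ 3 * ‖z‖ := by linarith [norm_add_le z w]
      have h4 : b - a = (‖z + w‖ - ‖z‖) * (‖z + w‖ + ‖z‖) := by rw [ha, hb]; ring
      have h5 : (‖z + w‖ - ‖z‖) ^ 2 ≤ ‖w‖ ^ 2 := sq_le_sq' (by linarith [abs_le.1 h2])
        (abs_le.1 h2).2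
      have h6 : (‖z + w‖ + ‖z‖) ^ 2 ≤ (3 * ‖z‖) ^ 2 := pow_le_pow_left₀ (by positivity) h3 2
      rw [h4, mul_pow, ha]
      calc _ ≤ ‖w‖ ^ 2 * (3 * ‖z‖) ^ 2 := mul_le_mul h5 h6 (sq_nonneg _) (sq_nonneg _)
        _ = _ := by ring
    have h7 := abs_log_le_add hw0 h.le hz
    have h8 : |Real.log a + 1| ≤ 2 * (|Real.log ‖w‖| + |Real.log M|) + 1 := by
      refine (abs_add_le _ _).trans ?_
      rw [ha, Real.log_pow, abs_mul]
      norm_num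
      linarith
    rw [e]
    refine (abs_add_le _ _).trans ?_
    have h9 := abs_mul_log_sub_le ha0 (by positivity : 0 ≤ b)
    rw [abs_mul, abs_of_nonneg (sq_nonneg ‖w‖)]
    have h10 := mul_le_mul_of_nonneg_right h8 (sq_nonneg ‖w‖)
    unfold logModulus
    have h11 := mul_nonneg (sq_nonneg ‖w‖) (abs_nonneg (Real.log ‖w‖))
    have h12 := mul_nonneg h11 hM
    nlinarith

/-! ### The Sobolev embedding `H¹(ℝ⁺) ⊆ L^∞(ℝ⁺)` -/

/-- Hölder's inequality on an interval of length at most `2`; the sharp constant `√2` is relaxed to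
`2`. -/
theorem integrableOn_Ioc_and_integral_norm_le {f : ℝ → ℂ} (hf : MemLp f 2 (volume.restrict (Ioi 0))) {a b : ℝ}
    (ha : 0 ≤ a) (hb : b ≤ a + 2) :
    IntegrableOn f (Ioc a b) ∧ ∫ x in Ioc a b, ‖f x‖ ≤ 2 * l2Norm f := by
  have hs : Ioc a b ⊆ Ioi 0 := fun x hx => ha.trans_lt hx.1
  have hm : volume.restrict (Ioc a b) ≤ volume.restrict (Ioi (0 : ℝ)) :=
    Measure.restrict_mono hs le_rfl
  have hf' : MemLp f 2 (volume.restrict (Ioc a b)) := hf.mono_measure hm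
  have hi : IntegrableOn f (Ioc a b) := hf'.integrable (by norm_num)
  refine ⟨hi, ?_⟩
  rw [integral_norm_eq_lintegral_enorm hi.1, ← eLpNorm_one_eq_lintegral_enorm, l2Norm,
    ← ENNReal.toReal_ofNat, ← ENNReal.toReal_mul]
  refine ENNReal.toReal_mono (ENNReal.mul_ne_top (by norm_num) hf.2.ne) ?_
  refine (eLpNorm_le_eLpNorm_mul_rpow_measure_univ (q := 2) (by norm_num) hi.1).trans ?_
  rw [mul_comm]
  refine mul_le_mul' ?_ (eLpNorm_mono_measure _ hm)
  have h2 : (volume.restrict (Ioc a b)) univ ≤ 2 := by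
    rw [Measure.restrict_apply_univ, Real.volume_Ioc]
    exact ENNReal.ofReal_le_of_le_toReal (by simp; linarith)
  calc _ ≤ (2 : ℝ≥0∞) ^ ((1 : ℝ≥0∞).toReal⁻¹ - (2 : ℝ≥0∞).toReal⁻¹ : ℝ) := by
        simp only [one_div]
        exact ENNReal.rpow_le_rpow h2 (by norm_num)
    _ ≤ 2 ^ (1 : ℝ) := ENNReal.rpow_le_rpow_of_exponent_le (by norm_num) (by norm_num)
    _ = _ := by simp

theorem deriv_smoothTransition_eq_zero {x : ℝ} (hx : x ∉ Icc (0 : ℝ) 1) :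
    deriv Real.smoothTransition x = 0 := by
  rcases not_and_or.1 hx with h | h
  · have : Real.smoothTransition =ᶠ[nhds x] fun _ => 0 :=
      Filter.mem_of_superset (Iio_mem_nhds (not_le.1 h))
        fun y hy => Real.smoothTransition.zero_of_nonpos (le_of_lt hy)
    rw [this.deriv_eq, deriv_const]
  · have : Real.smoothTransition =ᶠ[nhds x] fun _ => 1 :=
      Filter.mem_of_superset (Ioi_mem_nhds (not_le.1 h))
        fun y hy => Real.smoothTransition.one_of_one_le (le_of_lt hy)
    rw [this.deriv_eq, deriv_const]

theorem continuous_deriv_smoothTransition : Continuous (deriv Real.smoothTransition) :=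
  (Real.smoothTransition.contDiff (n := 1)).continuous_deriv le_rfl

theorem integral_deriv_smoothTransition :
    ∫ y in (0 : ℝ)..1, deriv Real.smoothTransition y = 1 := by
  rw [intervalIntegral.integral_deriv_eq_sub
    (fun x _ => (Real.smoothTransition.contDiff (n := 1)).differentiable one_ne_zero x)
    (continuous_deriv_smoothTransition.intervalIntegrable _ _)]
  simp

theorem exists_abs_deriv_smoothTransition_le :
    ∃ K, 0 ≤ K ∧ ∀ x, |deriv Real.smoothTransition x| ≤ K := by
  obtain ⟨K, hK⟩ := (isCompact_Icc (a := (0 : ℝ)) (b := 1)).exists_bound_of_continuousOn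
    continuous_deriv_smoothTransition.continuousOn
  refine ⟨max K 0, le_max_right _ _, fun x => ?_⟩
  by_cases hx : x ∈ Icc (0 : ℝ) 1
  · exact (hK x hx).trans (le_max_left _ _)
  · simp [deriv_smoothTransition_eq_zero hx]

/-- The smooth step from `0` at `a` to `1` at `a + ε`. -/
noncomputable def smoothStep (a ε x : ℝ) : ℝ := Real.smoothTransition (ε⁻¹ * (x - a))

theorem hasDerivAt_smoothStep (a ε x : ℝ) :
    HasDerivAt (smoothStep a ε) (ε⁻¹ * deriv Real.smoothTransition (ε⁻¹ * (x - a))) x := by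
  have h1 : HasDerivAt (fun x : ℝ => ε⁻¹ * (x - a)) ε⁻¹ x := by
    simpa using ((hasDerivAt_id x).sub_const a).const_mul ε⁻¹
  have h2 := ((Real.smoothTransition.contDiff (n := 1)).differentiable one_ne_zero
    (ε⁻¹ * (x - a))).hasDerivAt
  rw [mul_comm]
  exact h2.comp x h1

theorem contDiff_smoothStep (a ε : ℝ) : ContDiff ℝ ∞ (smoothStep a ε) :=
  Real.smoothTransition.contDiff.comp (by fun_prop)

theorem deriv_smoothStep_eq_zero {a ε x : ℝ} (hε : 0 < ε) (hx : x ∉ Icc a (a + ε)) :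
    deriv (smoothStep a ε) x = 0 := by
  rw [(hasDerivAt_smoothStep a ε x).deriv, deriv_smoothTransition_eq_zero, mul_zero]
  intro h
  apply hx
  rw [mem_Icc, inv_mul_eq_div, le_div_iff₀ hε, div_le_iff₀ hε] at h
  constructor <;> linarith [h.1, h.2]

/-- Under `x = a + ε y` the factor `ε⁻¹` from the derivative cancels the Jacobian. The right side is
a weighted average of `f` over `[a, a + ε]` that still makes sense at `ε = 0`, where it equals `f
a`. -/
theorem setIntegral_deriv_smoothStep_smul {a ε : ℝ} (ha : 0 < a) (hε : 0 < ε) (f : ℝ → ℂ) :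
    ∫ x in Ioi 0, deriv (smoothStep a ε) x • f x
      = ∫ y in (0 : ℝ)..1, deriv Real.smoothTransition y • f (a + ε * y) := by
  have h1 : ∫ x in Ioi 0, deriv (smoothStep a ε) x • f x
      = ∫ x in Icc a (a + ε), deriv (smoothStep a ε) x • f x := by
    apply setIntegral_eq_of_subset_of_forall_sdiff_eq_zero measurableSet_Ioi
    · exact fun x hx => ha.trans_le hx.1
    · exact fun x hx => by rw [deriv_smoothStep_eq_zero hε hx.2, zero_smul]
  rw [h1, integral_Icc_eq_integral_Ioc, ← intervalIntegral.integral_of_le (by linarith)]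
  have h2 := intervalIntegral.smul_integral_comp_add_mul (a := 0) (b := 1)
    (fun x => deriv (smoothStep a ε) x • f x) ε a
  rw [mul_zero, mul_one, add_zero] at h2
  rw [← h2, ← intervalIntegral.integral_smul]
  refine intervalIntegral.integral_congr fun y _ => ?_
  rw [(hasDerivAt_smoothStep a ε _).deriv, add_sub_cancel_left, inv_mul_cancel_left₀ hε.ne',
    smul_smul, mul_inv_cancel_left₀ hε.ne']

/-- The test function argument for the Sobolev embedding. -/
theorem norm_integral_smoothTransition_le {f g : ℝ → ℂ} (hc : Continuous f)
    (hg : MemLp g 2 (volume.restrict (Ioi 0))) (h : HasWeakDeriv f g) {a ε : ℝ} (ha : 0 < a)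
    (hε : 0 < ε) (hε1 : ε ≤ 1) :
    ‖(∫ y in (0 : ℝ)..1, deriv Real.smoothTransition y • f (a + ε * y))
      - ∫ y in (0 : ℝ)..1, deriv Real.smoothTransition y • f (a + 1 + 1 * y)‖ ≤ 2 * l2Norm g := by
  -- A smooth plateau that rises on `[a, a + ε]` and falls on `[a + 1, a + 2]`. Its derivative
  -- yields the difference of two averages of `f`, while `|φ| ≤ 1` bounds the pairing with `g` by `∫
  -- ‖g‖` over `[a, a + 2]`.
  set φ : ℝ → ℝ := fun x => smoothStep a ε x - smoothStep (a + 1) 1 x with hφ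
  have hφd : ContDiff ℝ ∞ φ := (contDiff_smoothStep _ _).sub (contDiff_smoothStep _ _)
  have hφ0 : ∀ x, x ∉ Icc a (a + 2) → φ x = 0 := by
    intro x hx
    rcases not_and_or.1 hx with h | h
    · have h1 : ε⁻¹ * (x - a) ≤ 0 :=
        mul_nonpos_of_nonneg_of_nonpos (by positivity) (by linarith)
      simp only [hφ, smoothStep]
      rw [Real.smoothTransition.zero_of_nonpos h1,
        Real.smoothTransition.zero_of_nonpos (by linarith), sub_self]
    · have h1 : 1 ≤ ε⁻¹ * (x - a) := by
        rw [inv_mul_eq_div, le_div_iff₀ hε]; linarith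
      simp only [hφ, smoothStep]
      rw [Real.smoothTransition.one_of_one_le h1,
        Real.smoothTransition.one_of_one_le (by linarith), sub_self]
  have hts : tsupport φ ⊆ Icc a (a + 2) := closure_minimal
    (fun x hx => by by_contra h; exact hx (hφ0 x h)) isClosed_Icc
  have hcs : HasCompactSupport φ := isCompact_Icc.of_isClosed_subset (isClosed_tsupport _) hts
  have hIcc : Icc a (a + 2) ⊆ Ioi 0 := fun x hx => ha.trans_le hx.1
  have key := h.2.2 φ hφd hcs (hts.trans hIcc)
  have hd : ∀ x, deriv φ x = deriv (smoothStep a ε) x - deriv (smoothStep (a + 1) 1) x :=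
    fun x => deriv_sub (hasDerivAt_smoothStep _ _ _).differentiableAt
      (hasDerivAt_smoothStep _ _ _).differentiableAt
  have hint : ∀ b δ : ℝ, 0 < b → 0 < δ →
      IntegrableOn (fun x => deriv (smoothStep b δ) x • f x) (Ioi 0) := by
    intro b δ hb hδ
    have hcont : Continuous (deriv (smoothStep b δ)) :=
      (contDiff_smoothStep b δ).continuous_deriv (by simp)
    have h1 : tsupport (deriv (smoothStep b δ)) ⊆ Icc b (b + δ) := by
      refine closure_minimal (fun x hx => ?_) isClosed_Icc
      by_contra hx'
      exact hx (deriv_smoothStep_eq_zero hδ hx')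
    exact integrable_smul_of_test (hc.locallyIntegrable.locallyIntegrableOn _) hcont
      (isCompact_Icc.of_isClosed_subset (isClosed_tsupport _) h1)
      (h1.trans fun x hx => hb.trans_le hx.1)
  have e : ∫ x in Ioi 0, deriv φ x • f x
      = (∫ y in (0 : ℝ)..1, deriv Real.smoothTransition y • f (a + ε * y))
      - ∫ y in (0 : ℝ)..1, deriv Real.smoothTransition y • f (a + 1 + 1 * y) := by
    rw [← setIntegral_deriv_smoothStep_smul ha hε f,
      ← setIntegral_deriv_smoothStep_smul (by linarith) one_pos f,
      ← integral_sub (hint _ _ ha hε) (hint _ _ (by linarith) one_pos)]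
    simp only [hd, sub_smul]
  obtain ⟨hgi, hgl⟩ := integrableOn_Ioc_and_integral_norm_le hg ha.le (le_refl (a + 2))
  have e2 : ∫ x in Ioi 0, φ x • g x = ∫ x in Ioc a (a + 2), φ x • g x := by
    rw [← integral_Icc_eq_integral_Ioc]
    apply setIntegral_eq_of_subset_of_forall_sdiff_eq_zero measurableSet_Ioi hIcc
    exact fun x hx => by rw [hφ0 x hx.2, zero_smul]
  rw [← e, key, norm_neg, e2]
  refine (norm_integral_le_of_norm_le hgi.norm (ae_of_all _ fun x => ?_)).trans hgl
  rw [norm_smul]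
  refine mul_le_of_le_one_left (norm_nonneg _) ?_
  rw [Real.norm_eq_abs, abs_le]
  simp only [hφ, smoothStep]
  constructor <;> linarith [Real.smoothTransition.nonneg (ε⁻¹ * (x - a)),
    Real.smoothTransition.le_one (ε⁻¹ * (x - a)),
    Real.smoothTransition.nonneg ((1 : ℝ)⁻¹ * (x - (a + 1))),
    Real.smoothTransition.le_one ((1 : ℝ)⁻¹ * (x - (a + 1)))]

/-- The Sobolev embedding on the half-line. -/
theorem exists_norm_le_h1Norm : ∃ S, 0 < S ∧ ∀ f : ℝ → ℂ, Continuous f → MemH1 f →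
    ∀ x, 0 ≤ x → ‖f x‖ ≤ S * h1Norm f := by
  obtain ⟨K, hK0, hK⟩ := exists_abs_deriv_smoothTransition_le
  refine ⟨2 * K + 2, by linarith, fun f hc hf => ?_⟩
  have hl2 : l2Norm f ≤ h1Norm f :=
    Real.le_sqrt_of_sq_le (by linarith [sq_nonneg (l2Norm (weakDeriv f))])
  have hl2' : l2Norm (weakDeriv f) ≤ h1Norm f :=
    Real.le_sqrt_of_sq_le (by linarith [sq_nonneg (l2Norm f)])
  have hpos : ∀ a, a ∈ Ioi (0 : ℝ) → ‖f a‖ ≤ (2 * K + 2) * h1Norm f := by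
    intro a ha
    have ha : 0 < a := ha
    set J : ℝ → ℂ := fun ε => ∫ y in (0 : ℝ)..1, deriv Real.smoothTransition y • f (a + ε * y)
      with hJ
    set R : ℂ := ∫ y in (0 : ℝ)..1, deriv Real.smoothTransition y • f (a + 1 + 1 * y) with hR
    have hJc : Continuous J := by
      have := continuous_deriv_smoothTransition
      refine intervalIntegral.continuous_parametric_intervalIntegral_of_continuous' ?_ 0 1
      fun_prop
    have hJ0 : J 0 = f a := by
      simp only [hJ, zero_mul, add_zero]
      rw [intervalIntegral.integral_smul_const, integral_deriv_smoothTransition, one_smul]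
    -- Letting `ε → 0` recovers the point value `f a`; it is compared with the average `R` over `[a
    -- + 1, a + 2]`, which the `L²` norm of `f` controls.
    have hlim : ‖J 0 - R‖ ≤ 2 * l2Norm (weakDeriv f) := by
      have ht : Filter.Tendsto (fun ε => ‖J ε - R‖) (nhdsWithin 0 (Ioi 0)) (nhds ‖J 0 - R‖) :=
        ((hJc.sub continuous_const).norm.tendsto 0).mono_left nhdsWithin_le_nhds
      refine le_of_tendsto ht ?_
      filter_upwards [Ioc_mem_nhdsGT (zero_lt_one' ℝ)] with ε hε
      exact norm_integral_smoothTransition_le hc (weakDeriv_memLp hf) (hasWeakDeriv_weakDeriv hf)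
        ha hε.1 hε.2
    have hR' : ‖R‖ ≤ K * (2 * l2Norm f) := by
      have e : R = ∫ x in (a + 1)..(a + 2),
          deriv Real.smoothTransition (x - (a + 1)) • f x := by
        have h2 := intervalIntegral.integral_comp_add_left (a := 0) (b := 1)
          (fun x => deriv Real.smoothTransition (x - (a + 1)) • f x) (a + 1)
        rw [add_zero, show a + 1 + 1 = a + 2 by ring] at h2
        rw [← h2, hR]
        simp
      obtain ⟨hi, hl⟩ := integrableOn_Ioc_and_integral_norm_le hf.1 (a := a + 1) (b := a + 2) (by linarith)
        (by linarith)
      rw [e, intervalIntegral.integral_of_le (by linarith)]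
      refine (norm_integral_le_of_norm_le (hi.norm.const_mul K) (ae_of_all _ fun x => ?_)).trans ?_
      · rw [norm_smul]
        exact mul_le_mul_of_nonneg_right (hK _) (norm_nonneg _)
      · rw [integral_const_mul]
        exact mul_le_mul_of_nonneg_left hl hK0
    have h1 : ‖f a‖ ≤ ‖J 0 - R‖ + ‖R‖ := by
      rw [← hJ0]; simpa using norm_add_le (J 0 - R) R
    nlinarith [mul_le_mul_of_nonneg_left hl2 hK0]
  intro x hx
  -- The endpoint `0`, needed for the vertex value, is reached by continuity.
  have hcl : IsClosed {x | ‖f x‖ ≤ (2 * K + 2) * h1Norm f} :=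
    isClosed_le hc.norm continuous_const
  have := hcl.closure_subset_iff.2 hpos
  rw [closure_Ioi] at this
  exact this hx

/-! ### Embeddings of the energy space -/

variable {N : ℕ}

theorem W.continuous_on (u : W N) (e : Fin N) : Continuous (u.on e) := by
  unfold W.on edge; fun_prop

theorem W.on_sub (u v : W N) (e : Fin N) : (u - v).on e = u.on e - v.on e := rfl

theorem W.on_zero (e : Fin N) : (0 : W N).on e = 0 := rfl

theorem W.on_real_smul (c : ℝ) (u : W N) (e : Fin N) : (c • u).on e = (c : ℂ) • u.on e := rfl

theorem W.wHalfNorm_le (u : W N) (e : Fin N) : wHalfNorm (u.on e) ≤ ‖u‖ := by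
  rw [W.norm_def]
  refine Real.le_sqrt_of_sq_le ?_
  exact Finset.single_le_sum (f := fun e => wHalfNorm (u.on e) ^ 2) (fun _ _ => sq_nonneg _)
    (Finset.mem_univ e)

theorem W.h1Norm_le (u : W N) (e : Fin N) : h1Norm (u.on e) ≤ ‖u‖ :=
  (le_add_of_nonneg_right (luxNorm_nonneg _)).trans (u.wHalfNorm_le e)

theorem W.luxNorm_le (u : W N) (e : Fin N) : luxNorm (u.on e) ≤ ‖u‖ :=
  (le_add_of_nonneg_left (h1Norm_nonneg _)).trans (u.wHalfNorm_le e)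

theorem W.l2Norm_deriv_le (u : W N) (e : Fin N) : l2Norm (u.deriv e) ≤ ‖u‖ :=
  (Real.le_sqrt_of_sq_le (show l2Norm (weakDeriv (u.on e)) ^ 2 ≤ _ by
    linarith [sq_nonneg (l2Norm (u.on e))])).trans (u.h1Norm_le e)

theorem W.exists_norm_on_le (N : ℕ) : ∃ S, 0 < S ∧ ∀ (u : W N) (e : Fin N) (x : ℝ), 0 ≤ x →
    ‖u.on e x‖ ≤ S * ‖u‖ := by
  obtain ⟨S, hS, h⟩ := exists_norm_le_h1Norm
  exact ⟨S, hS, fun u e x hx => (h _ (u.continuous_on e) (u.mem e).1 x hx).trans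
    (mul_le_mul_of_nonneg_left (u.h1Norm_le e) hS.le)⟩

/-- An admissible `k < 2` exists as the infimum is at most `1`, and `A(2 s) ≤ 4 A(s)` gives the
bound `4` without showing that the infimum is attained. -/
theorem setIntegral_orliczA_le {f : ℝ → ℂ} (hf : MemLA f) (h : luxNorm f ≤ 1) :
    ∫ x in Ioi 0, orliczA ‖f x‖ ≤ 4 := by
  obtain ⟨k, ⟨hk0, hk1⟩, hk2⟩ := exists_lt_of_csInf_lt (luxSet_nonempty hf)
    (show sInf (luxSet f) < 2 from lt_of_le_of_lt h one_lt_two)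
  rw [integral_eq_lintegral_of_nonneg_ae (ae_of_all _ fun x => orliczA_nonneg (norm_nonneg _))
    hf.2.1]
  refine ENNReal.toReal_le_of_le_ofReal (by norm_num) ?_
  calc ∫⁻ x in Ioi 0, ENNReal.ofReal (orliczA ‖f x‖)
      ≤ ∫⁻ x in Ioi 0, ENNReal.ofReal 4 * ENNReal.ofReal (orliczA (k⁻¹ * ‖f x‖)) := by
        refine lintegral_mono fun x => ?_
        rw [← ENNReal.ofReal_mul (by norm_num)]
        refine ENNReal.ofReal_le_ofReal ?_
        have h0 : 0 ≤ k⁻¹ * ‖f x‖ := by positivity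
        have h1 := orliczA_mul_le_sq (by norm_num : (1 : ℝ) ≤ 2) h0
        have e : ‖f x‖ = k * (k⁻¹ * ‖f x‖) := by field_simp
        have h2 := orliczA_mono (norm_nonneg (f x))
          (e.le.trans (mul_le_mul_of_nonneg_right hk2.le h0))
        linarith
    _ ≤ ENNReal.ofReal 4 * 1 := by
        rw [lintegral_const_mul' _ _ ENNReal.ofReal_ne_top]
        exact mul_le_mul_right hk1 _
    _ = ENNReal.ofReal 4 := mul_one _

/-- Pairings with the modulus of the logarithmic nonlinearity are controlled by the norm
of `W(Γ)`. -/
theorem W.exists_integral_logModulus_mul_le (N : ℕ) : ∃ C, 0 ≤ C ∧ ∀ (u v : W N) (e : Fin N),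
    IntegrableOn (fun x => logModulus ‖u.on e x‖ * ‖v.on e x‖) (Ioi 0) ∧
      ∫ x in Ioi 0, logModulus ‖u.on e x‖ * ‖v.on e x‖ ≤ C * logModulus ‖u‖ * ‖v‖ := by
  obtain ⟨S, hS, hsup⟩ := W.exists_norm_on_le N
  set L : ℝ := 4 * (4 + |Real.log S|) with hL
  have hL0 : 0 ≤ L := by positivity
  have hmeas : ∀ (u v : W N) (e : Fin N), AEStronglyMeasurable
      (fun x => logModulus ‖u.on e x‖ * ‖v.on e x‖) (volume.restrict (Ioi 0)) := fun u v e =>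
    ((continuous_logModulus.comp (u.continuous_on e).norm).mul
      (v.continuous_on e).norm).aestronglyMeasurable
  -- On the unit ball both functions are bounded by `S`, so the Young type inequality applies with
  -- `M = S`; the factor `8` is `4 + 4` from the two integrals of `A`.
  have hunit : ∀ (u v : W N) (e : Fin N), ‖u‖ ≤ 1 → ‖v‖ ≤ 1 →
      IntegrableOn (fun x => logModulus ‖u.on e x‖ * ‖v.on e x‖) (Ioi 0) ∧
      ∫ x in Ioi 0, logModulus ‖u.on e x‖ * ‖v.on e x‖ ≤ L * 8 := by
    intro u v e hu hv
    have hbd : ∀ᵐ x ∂(volume.restrict (Ioi 0)), logModulus ‖u.on e x‖ * ‖v.on e x‖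
        ≤ L * (orliczA ‖u.on e x‖ + orliczA ‖v.on e x‖) := by
      filter_upwards [ae_restrict_mem measurableSet_Ioi] with x hx
      have hx : 0 < x := hx
      exact logModulus_mul_le_orliczA (norm_nonneg _)
        ((hsup u e x hx.le).trans (mul_le_of_le_one_right hS.le hu)) (norm_nonneg _)
        ((hsup v e x hx.le).trans (mul_le_of_le_one_right hS.le hv))
    have hi : IntegrableOn (fun x => L * (orliczA ‖u.on e x‖ + orliczA ‖v.on e x‖)) (Ioi 0) :=
      ((u.mem e).2.2.add (v.mem e).2.2).const_mul L
    have hi' : IntegrableOn (fun x => logModulus ‖u.on e x‖ * ‖v.on e x‖) (Ioi 0) := by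
      refine hi.mono' (hmeas u v e) (hbd.mono fun x hx => ?_)
      rwa [Real.norm_of_nonneg (mul_nonneg (logModulus_nonneg (norm_nonneg _)) (norm_nonneg _))]
    refine ⟨hi', (integral_mono_ae hi' hi hbd).trans ?_⟩
    rw [integral_const_mul, integral_add (u.mem e).2.2 (v.mem e).2.2]
    have h1 := setIntegral_orliczA_le (u.mem e).2 ((u.luxNorm_le e).trans hu)
    have h2 := setIntegral_orliczA_le (v.mem e).2 ((v.luxNorm_le e).trans hv)
    exact mul_le_mul_of_nonneg_left (by linarith) hL0
  have hscale : ∀ u : W N, ∃ u' : W N, ‖u'‖ ≤ 1 ∧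
      ∀ e x, ‖u.on e x‖ = ‖u‖ * ‖u'.on e x‖ := by
    intro u
    rcases eq_or_ne u 0 with rfl | hu
    · exact ⟨0, by simp, fun e x => by simp [W.on_zero]⟩
    have hu0 : 0 < ‖u‖ := norm_pos_iff.2 hu
    refine ⟨((‖u‖⁻¹ : ℝ) : ℂ) • u, ?_, fun e x => ?_⟩
    · rw [norm_smul, Complex.norm_real, norm_inv, norm_norm, inv_mul_cancel₀ hu0.ne']
    · rw [W.on_smul, Pi.smul_apply, norm_smul, Complex.norm_real, norm_inv, norm_norm,
        mul_inv_cancel_left₀ hu0.ne']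
  refine ⟨L * 8, by positivity, fun u v e => ?_⟩
  obtain ⟨u', hu', hue⟩ := hscale u
  obtain ⟨v', hv', hve⟩ := hscale v
  obtain ⟨hi, hle⟩ := hunit u' v' e hu' hv'
  have hp := logModulus_nonneg (norm_nonneg u)
  -- Submultiplicativity extracts `ω(‖u‖)` from the first factor, while the second scales linearly.
  have hbd : ∀ x, logModulus ‖u.on e x‖ * ‖v.on e x‖
      ≤ logModulus ‖u‖ * ‖v‖ * (logModulus ‖u'.on e x‖ * ‖v'.on e x‖) := by
    intro x
    rw [hue, hve]
    have := mul_le_mul_of_nonneg_right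
      (logModulus_mul_le (norm_nonneg u) (norm_nonneg (u'.on e x)))
      (by positivity : 0 ≤ ‖v‖ * ‖v'.on e x‖)
    linarith
  have hi2 := hi.const_mul (logModulus ‖u‖ * ‖v‖)
  have hi' : IntegrableOn (fun x => logModulus ‖u.on e x‖ * ‖v.on e x‖) (Ioi 0) := by
    refine hi2.mono' (hmeas u v e) (ae_of_all _ fun x => ?_)
    rw [Real.norm_of_nonneg (mul_nonneg (logModulus_nonneg (norm_nonneg _)) (norm_nonneg _))]
    exact hbd x
  refine ⟨hi', (integral_mono hi' hi2 hbd).trans ?_⟩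
  rw [integral_const_mul]
  calc _ ≤ logModulus ‖u‖ * ‖v‖ * (L * 8) := mul_le_mul_of_nonneg_left hle (by positivity)
    _ = _ := by ring

/-! ### Functionals given by functions -/

theorem W.integrableOn_mul_conj {f : ℝ → ℂ} {v : W N} {e : Fin N}
    (hm : AEStronglyMeasurable f (volume.restrict (Ioi 0)))
    (hi : IntegrableOn (fun x => ‖f x‖ * ‖v.on e x‖) (Ioi 0)) :
    IntegrableOn (fun x => f x * conj (v.on e x)) (Ioi 0) := by
  refine hi.mono' (hm.mul (Complex.continuous_conj.comp (v.continuous_on e)).aestronglyMeasurable)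
    (ae_of_all _ fun x => ?_)
  rw [norm_mul, RCLike.norm_conj]

theorem abs_sum_integral_re_le {f : Fin N → ℝ → ℂ} {K : ℝ} {v : W N}
    (hK : ∀ e, IntegrableOn (fun x => ‖f e x‖ * ‖v.on e x‖) (Ioi 0) ∧
      ∫ x in Ioi 0, ‖f e x‖ * ‖v.on e x‖ ≤ K * ‖v‖) :
    |∑ e, ∫ x in Ioi 0, (f e x * conj (v.on e x)).re| ≤ N * K * ‖v‖ := by
  refine (Finset.abs_sum_le_sum_abs _ _).trans ?_
  calc _ ≤ ∑ _e : Fin N, K * ‖v‖ := by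
        refine Finset.sum_le_sum fun e _ => ?_
        rw [← Real.norm_eq_abs]
        refine (norm_integral_le_of_norm_le (hK e).1 (ae_of_all _ fun x => ?_)).trans (hK e).2
        refine (Complex.abs_re_le_norm _).trans ?_
        rw [norm_mul, RCLike.norm_conj]
    _ = _ := by simp; ring

theorem exists_isGivenBy {f : Fin N → ℝ → ℂ} {K : ℝ}
    (hm : ∀ e, AEStronglyMeasurable (f e) (volume.restrict (Ioi 0)))
    (hK : ∀ (v : W N) (e : Fin N), IntegrableOn (fun x => ‖f e x‖ * ‖v.on e x‖) (Ioi 0) ∧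
      ∫ x in Ioi 0, ‖f e x‖ * ‖v.on e x‖ ≤ K * ‖v‖) :
    ∃ T : W' N, IsGivenBy f T := by
  have hi : ∀ (v : W N) e, IntegrableOn (fun x => f e x * conj (v.on e x)) (Ioi 0) :=
    fun v e => W.integrableOn_mul_conj (hm e) (hK v e).1
  have hre : ∀ (v : W N) e, IntegrableOn (fun x => (f e x * conj (v.on e x)).re) (Ioi 0) :=
    fun v e => (hi v e).re
  let T : W N →ₗ[ℝ] ℝ :=
    { toFun := fun v => ∑ e, ∫ x in Ioi 0, (f e x * conj (v.on e x)).re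
      map_add' := fun v w => by
        rw [← Finset.sum_add_distrib]
        refine Finset.sum_congr rfl fun e _ => ?_
        rw [← integral_add (hre v e) (hre w e)]
        simp only [W.on_add, Pi.add_apply, map_add, mul_add, Complex.add_re]
      map_smul' := fun c v => by
        rw [RingHom.id_apply, smul_eq_mul, Finset.mul_sum]
        refine Finset.sum_congr rfl fun e _ => ?_
        rw [← integral_const_mul]
        refine integral_congr_ae (ae_of_all _ fun x => ?_)
        simp only [W.on_real_smul, Pi.smul_apply, smul_eq_mul, map_mul, Complex.conj_ofReal]
        rw [mul_left_comm, Complex.re_ofReal_mul] }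
  exact ⟨T.mkContinuous (N * K) fun v => abs_sum_integral_re_le (hK v), fun v => ⟨hi v, rfl⟩⟩

theorem IsGivenBy.sub {f g : Fin N → ℝ → ℂ} {S T : W' N} (hf : IsGivenBy f S)
    (hg : IsGivenBy g T) : IsGivenBy (fun e => f e - g e) (S - T) := by
  intro v
  have e1 : ∀ e x, (f e - g e) x * conj (v.on e x)
      = f e x * conj (v.on e x) - g e x * conj (v.on e x) := fun e x => sub_mul _ _ _
  simp only [e1, Complex.sub_re]
  refine ⟨fun e => ((hf v).1 e).sub ((hg v).1 e), ?_⟩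
  rw [sub_apply, (hf v).2, (hg v).2, ← Finset.sum_sub_distrib]
  exact Finset.sum_congr rfl fun e _ => (integral_sub ((hf v).1 e).re ((hg v).1 e).re).symm

theorem IsGivenBy.add {f g : Fin N → ℝ → ℂ} {S T : W' N} (hf : IsGivenBy f S)
    (hg : IsGivenBy g T) : IsGivenBy (fun e => f e + g e) (S + T) := by
  intro v
  have e1 : ∀ e x, (f e + g e) x * conj (v.on e x)
      = f e x * conj (v.on e x) + g e x * conj (v.on e x) := fun e x => add_mul _ _ _
  simp only [e1, Complex.add_re]
  refine ⟨fun e => ((hf v).1 e).add ((hg v).1 e), ?_⟩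
  rw [add_apply, (hf v).2, (hg v).2, ← Finset.sum_add_distrib]
  exact Finset.sum_congr rfl fun e _ => (integral_add ((hf v).1 e).re ((hg v).1 e).re).symm

theorem IsGivenBy.norm_le {f : Fin N → ℝ → ℂ} {T : W' N} (hf : IsGivenBy f T) {K : ℝ}
    (hK0 : 0 ≤ K) (hK : ∀ (v : W N) (e : Fin N),
      IntegrableOn (fun x => ‖f e x‖ * ‖v.on e x‖) (Ioi 0) ∧
      ∫ x in Ioi 0, ‖f e x‖ * ‖v.on e x‖ ≤ K * ‖v‖) : ‖T‖ ≤ N * K := by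
  refine T.opNorm_le_bound (by positivity) fun v => ?_
  rw [(hf v).2]
  exact abs_sum_integral_re_le (hK v)

/-- A function dominated by the logarithmic modulus of an element of `W(Γ)` pairs with
`W(Γ)`. -/
theorem W.exists_integral_norm_mul_le (N : ℕ) : ∃ C, 0 ≤ C ∧
    ∀ (f : ℝ → ℂ) (c : ℝ) (u v : W N) (e : Fin N), 0 ≤ c →
      AEStronglyMeasurable f (volume.restrict (Ioi 0)) →
      (∀ x, 0 < x → ‖f x‖ ≤ c * logModulus ‖u.on e x‖) →
      IntegrableOn (fun x => ‖f x‖ * ‖v.on e x‖) (Ioi 0) ∧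
        ∫ x in Ioi 0, ‖f x‖ * ‖v.on e x‖ ≤ c * (C * logModulus ‖u‖) * ‖v‖ := by
  obtain ⟨C, hC, h⟩ := W.exists_integral_logModulus_mul_le N
  refine ⟨C, hC, fun f c u v e hc hm hf => ?_⟩
  obtain ⟨hi, hle⟩ := h u v e
  have hi2 := hi.const_mul c
  have hbd : ∀ᵐ x ∂(volume.restrict (Ioi 0)), ‖f x‖ * ‖v.on e x‖
      ≤ c * (logModulus ‖u.on e x‖ * ‖v.on e x‖) := by
    filter_upwards [ae_restrict_mem measurableSet_Ioi] with x hx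
    rw [← mul_assoc]
    exact mul_le_mul_of_nonneg_right (hf x hx) (norm_nonneg _)
  have hi' : IntegrableOn (fun x => ‖f x‖ * ‖v.on e x‖) (Ioi 0) := by
    refine hi2.mono' (hm.norm.mul (v.continuous_on e).norm.aestronglyMeasurable)
      (hbd.mono fun x hx => ?_)
    rwa [Real.norm_of_nonneg (by positivity)]
  refine ⟨hi', (integral_mono_ae hi' hi2 hbd).trans ?_⟩
  rw [integral_const_mul]
  calc _ ≤ c * (C * logModulus ‖u‖ * ‖v‖) := mul_le_mul_of_nonneg_left hle hc
    _ = _ := by ring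

theorem W.aestronglyMeasurable_on (u : W N) (e : Fin N) :
    AEStronglyMeasurable (u.on e) (volume.restrict (Ioi 0)) :=
  (u.continuous_on e).aestronglyMeasurable

theorem W.aestronglyMeasurable_logTerm (u : W N) (e : Fin N) :
    AEStronglyMeasurable (logTerm u e) (volume.restrict (Ioi 0)) :=
  (measurable_logMap.comp (u.continuous_on e).measurable).aestronglyMeasurable

theorem exists_isGivenBy_logTerm (u : W N) : ∃ T : W' N, IsGivenBy (logTerm u) T := by
  obtain ⟨C, hC, h⟩ := W.exists_integral_norm_mul_le N
  exact exists_isGivenBy (u.aestronglyMeasurable_logTerm) fun v e =>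
    h (logTerm u e) 2 u v e two_pos.le (u.aestronglyMeasurable_logTerm e)
      fun x _ => norm_logMap_le _

/-- Since `s ≤ ω(s)`, the pairing estimate for the logarithm also covers the identity term. -/
theorem exists_isGivenBy_on (u : W N) : ∃ T : W' N, IsGivenBy u.on T := by
  obtain ⟨C, hC, h⟩ := W.exists_integral_norm_mul_le N
  exact exists_isGivenBy (u.aestronglyMeasurable_on) fun v e =>
    h (u.on e) 1 u v e one_pos.le (u.aestronglyMeasurable_on e)
      fun x _ => by rw [one_mul]; exact le_logModulus (norm_nonneg _)

/-! ### The logarithmic part of the energy -/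

theorem W.integrableOn_logDensity (u : W N) (e : Fin N) :
    IntegrableOn (fun x => logDensity (u.on e x)) (Ioi 0) := by
  obtain ⟨C, -, h⟩ := W.exists_integral_logModulus_mul_le N
  refine ((h u u e).1.const_mul 2).mono'
    (measurable_logDensity.comp (u.continuous_on e).measurable).aestronglyMeasurable
    (ae_of_all _ fun x => abs_logDensity_le _)

/-- The logarithmic part `½ ∑_e ∫ |u_e|² Log |u_e|²` of the energy. -/
noncomputable def logEnergy (u : W N) : ℝ := 1 / 2 * ∑ e, ∫ x in Ioi 0, logDensity (u.on e x)

theorem tendsto_const_mul_logModulus_norm (c : ℝ) :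
    Filter.Tendsto (fun u : W N => c * logModulus ‖u‖) (nhds 0) (nhds 0) := by
  have : Continuous fun u : W N => c * logModulus ‖u‖ :=
    continuous_const.mul (continuous_logModulus.comp continuous_norm)
  simpa [logModulus_zero] using this.tendsto 0

theorem hasFDerivAt_logEnergy {u : W N} {T : W' N}
    (hT : IsGivenBy (fun e => logTerm u e + u.on e) T) : HasFDerivAt logEnergy T u := by
  obtain ⟨S, hS, hsup⟩ := W.exists_norm_on_le N
  obtain ⟨C, hC, hpair⟩ := W.exists_integral_logModulus_mul_le N
  -- Only `u` has to be bounded in the Taylor estimate, so `L` does not depend on the increment `w`.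
  -- For `u = 0` the convention `Real.log 0 = 0` is harmless.
  set L : ℝ := 40 + 2 * |Real.log (S * ‖u‖)| with hL
  have hL0 : 0 ≤ L := by positivity
  have hrem : ∀ w : W N, |logEnergy (u + w) - logEnergy u - T w|
      ≤ N * L * C * logModulus ‖w‖ * ‖w‖ := by
    intro w
    have e1 : logEnergy (u + w) - logEnergy u - T w = 1 / 2 * ∑ e, ∫ x in Ioi 0,
        (logDensity (u.on e x + w.on e x) - logDensity (u.on e x)
          - 2 * ((logMap (u.on e x) + u.on e x) * conj (w.on e x)).re) := by
      have e2 : ∀ e, ∫ x in Ioi 0, (logDensity (u.on e x + w.on e x) - logDensity (u.on e x)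
          - 2 * ((logMap (u.on e x) + u.on e x) * conj (w.on e x)).re)
          = (∫ x in Ioi 0, logDensity ((u + w).on e x)) - (∫ x in Ioi 0, logDensity (u.on e x))
            - 2 * ∫ x in Ioi 0, ((logTerm u e + u.on e) x * conj (w.on e x)).re := by
        intro e
        have h1 := (u + w).integrableOn_logDensity e
        have h2 := u.integrableOn_logDensity e
        have h3 : IntegrableOn (fun x => 2 * ((logTerm u e + u.on e) x * conj (w.on e x)).re)
            (Ioi 0) := ((hT w).1 e).re.const_mul 2
        rw [← integral_const_mul, ← integral_sub h1 h2]
        exact integral_sub (h1.sub h2) h3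
      simp only [e2]
      rw [Finset.sum_sub_distrib, Finset.sum_sub_distrib, ← Finset.mul_sum, (hT w).2, logEnergy,
        logEnergy]
      ring
    rw [e1, abs_mul]
    have h1 : |∑ e, ∫ x in Ioi 0, (logDensity (u.on e x + w.on e x) - logDensity (u.on e x)
          - 2 * ((logMap (u.on e x) + u.on e x) * conj (w.on e x)).re)|
        ≤ N * (L * (C * logModulus ‖w‖ * ‖w‖)) := by
      refine (Finset.abs_sum_le_sum_abs _ _).trans ?_
      calc _ ≤ ∑ _e : Fin N, L * (C * logModulus ‖w‖ * ‖w‖) := by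
            refine Finset.sum_le_sum fun e _ => ?_
            rw [← Real.norm_eq_abs]
            refine (norm_integral_le_of_norm_le ((hpair w w e).1.const_mul L) ?_).trans ?_
            · filter_upwards [ae_restrict_mem measurableSet_Ioi] with x hx
              exact abs_logDensity_add_sub_le (hsup u e x (le_of_lt hx))
            · rw [integral_const_mul]
              exact mul_le_mul_of_nonneg_left (hpair w w e).2 hL0
        _ = _ := by simp
    have h2 : |(1 / 2 : ℝ)| ≤ 1 := by norm_num [abs_le]
    refine (mul_le_of_le_one_left (abs_nonneg _) h2).trans (h1.trans (le_of_eq ?_))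
    ring
  rw [hasFDerivAt_iff_isLittleO_nhds_zero, Asymptotics.isLittleO_iff]
  intro c hc
  filter_upwards [(tendsto_const_mul_logModulus_norm (N * L * C)).eventually_le_const hc]
    with w hw
  exact (hrem w).trans (mul_le_mul_of_nonneg_right hw (norm_nonneg _))

theorem continuous_of_isGivenBy_logTerm {T : W N → W' N}
    (hT : ∀ u, IsGivenBy (fun e => logTerm u e + u.on e) (T u)) : Continuous T := by
  obtain ⟨S, hS, hsup⟩ := W.exists_norm_on_le N
  obtain ⟨C, hC, hpair⟩ := W.exists_integral_norm_mul_le N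
  refine continuous_iff_continuousAt.2 fun u => ?_
  -- A common pointwise bound for `u` and all `w` in the unit ball around it. In `L`, the constant
  -- `5` is `4` from the logarithm plus `1` from the identity term.
  set R : ℝ := S * (‖u‖ + 1) with hR
  set L : ℝ := 5 + 2 * |Real.log R| with hL
  have hL0 : 0 ≤ L := by positivity
  have hbd : ∀ w ∈ Metric.ball u 1, ‖T w - T u‖ ≤ N * L * C * logModulus ‖w - u‖ := by
    intro w hw
    have hwn : ‖w‖ ≤ ‖u‖ + 1 := by
      have := norm_sub_norm_le w u
      rw [mem_ball_iff_norm] at hw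
      linarith
    have hp := logModulus_nonneg (norm_nonneg (w - u))
    refine (((hT w).sub (hT u)).norm_le (K := L * (C * logModulus ‖w - u‖)) (by positivity)
      fun v e => ?_).trans (le_of_eq (by ring))
    refine hpair _ L (w - u) v e hL0 (((w.aestronglyMeasurable_logTerm e).add
      (w.aestronglyMeasurable_on e)).sub ((u.aestronglyMeasurable_logTerm e).add
      (u.aestronglyMeasurable_on e))) fun x hx => ?_
    have h1 : ‖logMap (w.on e x) - logMap (u.on e x)‖
        ≤ (4 + 2 * |Real.log R|) * logModulus ‖w.on e x - u.on e x‖ :=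
      norm_logMap_sub_le
        ((hsup w e x hx.le).trans (mul_le_mul_of_nonneg_left hwn hS.le))
        ((hsup u e x hx.le).trans (mul_le_mul_of_nonneg_left (by linarith) hS.le))
    have h2 := le_logModulus (norm_nonneg (w.on e x - u.on e x))
    have e1 : (logTerm w e + w.on e - (logTerm u e + u.on e)) x
        = (logMap (w.on e x) - logMap (u.on e x)) + (w.on e x - u.on e x) :=
      add_sub_add_comm _ _ _ _
    rw [e1, W.on_sub, Pi.sub_apply]
    refine (norm_add_le _ _).trans ?_
    rw [hL]
    linarith
  refine tendsto_iff_norm_sub_tendsto_zero.2 (squeeze_zero' (.of_forall fun _ => norm_nonneg _)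
    (Filter.eventually_of_mem (Metric.ball_mem_nhds u one_pos) hbd) ?_)
  have h0 : Filter.Tendsto (fun w : W N => w - u) (nhds u) (nhds 0) := by
    simpa using (continuous_sub_right u).tendsto u
  exact (tendsto_const_mul_logModulus_norm (N * L * C)).comp h0

/-! ### The quadratic part of the energy -/

/-- The weak derivative on an edge as an operator from `W(Γ)` to `L²(ℝ⁺)`. -/
noncomputable def W.derivL (e : Fin N) : W N →L[ℝ] Lp ℂ 2 (volume.restrict (Ioi (0 : ℝ))) :=
  LinearMap.mkContinuous
    { toFun := fun u => (weakDeriv_memLp (u.mem e).1).toLp (weakDeriv (u.on e))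
      -- Weak derivatives are chosen representatives, additive only almost everywhere; linearity
      -- holds for their classes in `L²`.
      map_add' := fun u v => by
        rw [← MemLp.toLp_add]
        exact MemLp.toLp_congr _ _ (weakDeriv_add (u.mem e).1 (v.mem e).1)
      map_smul' := fun c u => by
        rw [RingHom.id_apply, ← MemLp.toLp_const_smul]
        exact MemLp.toLp_congr _ _ (weakDeriv_smul (c : ℂ) (u.mem e).1) }
    1 fun u => by
      rw [one_mul]
      refine le_trans (le_of_eq ?_) (u.l2Norm_deriv_le e)
      exact Lp.norm_toLp _ (weakDeriv_memLp (u.mem e).1)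

theorem W.inner_derivL (e : Fin N) (u v : W N) :
    inner ℝ (W.derivL e u) (W.derivL e v)
      = ∫ x in Ioi 0, (u.deriv e x * conj (v.deriv e x)).re := by
  rw [L2.inner_def]
  refine integral_congr_ae ?_
  filter_upwards [(weakDeriv_memLp (u.mem e).1).coeFn_toLp,
    (weakDeriv_memLp (v.mem e).1).coeFn_toLp] with x hu hv
  have hu' : (W.derivL e u) x = u.deriv e x := hu
  have hv' : (W.derivL e v) x = v.deriv e x := hv
  rw [hu', hv', real_inner_comm, Complex.inner, mul_comm]

/-- The trace at the vertex is continuous by the Sobolev bound at the endpoint `0` of edge `0`. -/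
theorem W.exists_vertex_eq [NeZero N] : ∃ V : W N →L[ℝ] ℂ, ∀ u, V u = u.vertex := by
  obtain ⟨S, hS, hsup⟩ := W.exists_norm_on_le N
  let V : W N →ₗ[ℝ] ℂ :=
    { toFun := fun u => u.vertex
      map_add' := fun u v => rfl
      map_smul' := fun c u => rfl }
  refine ⟨V.mkContinuous S fun u => ?_, fun u => rfl⟩
  have h := hsup u 0 0 le_rfl
  rwa [show u.on 0 0 = V u by simp [W.on, edge, V, W.vertex]] at h

/-- `𝔉_γ` is a continuous bilinear form on `W(Γ)`. -/
theorem exists_bilinForm_eq [NeZero N] (γ : ℝ) :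
    ∃ B : W N →L[ℝ] W' N, ∀ u v, B u v = bilinForm γ u v := by
  obtain ⟨V, hV⟩ := W.exists_vertex_eq (N := N)
  refine ⟨(∑ e, (innerSL ℝ).bilinearComp (W.derivL e) (W.derivL e))
    - γ • (innerSL ℝ).bilinearComp V V, fun u v => ?_⟩
  simp only [sub_apply, sum_apply,
    smul_apply, ContinuousLinearMap.bilinearComp_apply, innerSL_apply_apply,
    W.inner_derivL, hV, bilinForm, smul_eq_mul]
  rw [real_inner_comm, Complex.inner, mul_comm u.vertex]

theorem bilinForm_comm [NeZero N] (γ : ℝ) (u v : W N) : bilinForm γ u v = bilinForm γ v u := by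
  have h : ∀ z w : ℂ, (z * conj w).re = (w * conj z).re := fun z w => by
    simp [mul_comm]
  simp only [bilinForm, h]

theorem bilinForm_self [NeZero N] (γ : ℝ) (u : W N) : bilinForm γ u u = quadForm γ u := by
  have h : ∀ z : ℂ, (z * conj z).re = ‖z‖ ^ 2 := fun z => by
    rw [Complex.mul_conj, Complex.ofReal_re, Complex.normSq_eq_norm_sq]
  simp only [bilinForm, quadForm, h]

theorem hasFDerivAt_half_quadForm [NeZero N] {γ : ℝ} {B : W N →L[ℝ] W' N}
    (hB : ∀ u v, B u v = bilinForm γ u v) (u : W N) :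
    HasFDerivAt (fun u => 1 / 2 * quadForm γ u) (B u) u := by
  -- The derivative of `B u u` in direction `v` is `B u v + B v u`; symmetry makes the two terms
  -- equal, which absorbs the factor `1 / 2`.
  have h := (B.hasFDerivAt_of_bilinear (hasFDerivAt_id u) (hasFDerivAt_id u)).const_mul (1 / 2)
  simp only [id, hB, bilinForm_self] at h
  refine h.congr_fderiv ?_
  ext v
  simp [hB, bilinForm_comm γ v u]
  ring

end StarGraph

/-- The energy is well defined and of class `C¹` on `W(Γ)`, and its Fréchet derivative is
`E'(u) = -Δ_γ u - u Log |u|² - u`, each of the three terms being an element of `W'(Γ)`. -/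
theorem proposition7p1 (N : ℕ) [NeZero N] (γ : ℝ) :
    (∀ (u : StarGraph.W N) (e : Fin N),
      IntegrableOn (fun x => ‖u.on e x‖ ^ 2 * Real.log (‖u.on e x‖ ^ 2)) (Ioi 0)) ∧
    ContDiff ℝ 1 (StarGraph.energy γ : StarGraph.W N → ℝ) ∧
    ∀ u : StarGraph.W N, ∃ negLap logU idU : StarGraph.W' N,
      StarGraph.IsNegLaplacian γ u negLap ∧
      StarGraph.IsGivenBy (StarGraph.logTerm u) logU ∧
      StarGraph.IsGivenBy u.on idU ∧
      HasFDerivAt (StarGraph.energy γ) (negLap - logU - idU) u := by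
  obtain ⟨B, hB⟩ := StarGraph.exists_bilinForm_eq (N := N) γ
  -- Arbitrary choices suffice: the differentiability and continuity lemmas use only the pairing
  -- that characterises these functionals.
  choose logU hlog using StarGraph.exists_isGivenBy_logTerm (N := N)
  choose idU hid using StarGraph.exists_isGivenBy_on (N := N)
  have hsum : ∀ u, StarGraph.IsGivenBy (fun e => StarGraph.logTerm u e + u.on e)
      (logU u + idU u) := fun u => (hlog u).add (hid u)
  have hderiv : ∀ u, HasFDerivAt (StarGraph.energy γ) (B u - (logU u + idU u)) u := fun u =>
    (StarGraph.hasFDerivAt_half_quadForm hB u).sub (StarGraph.hasFDerivAt_logEnergy (hsum u))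
  refine ⟨fun u e => u.integrableOn_logDensity e, ?_, fun u => ⟨B u, logU u, idU u, hB u, hlog u,
    hid u, ?_⟩⟩
  · exact contDiff_one_iff_hasFDerivAt.2 ⟨_, B.continuous.sub
      (StarGraph.continuous_of_isGivenBy_logTerm hsum), hderiv⟩
  · rw [sub_sub]
    exact hderiv u
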